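/- Let $a<b$, $T>0$, $0<\gamma<1$, and let $u$ be a solution of $$\frac{\partial u}{\partial t}(x,t)+\int_a^b\frac{u(x,t)-u(y,t)}{|x-y|^{\gamma}}\,dy=f(x,t),\qquad (x,t)\in(a,b)\times(0,T],$$ with initial condition $u(x,0)=u_0(x)$ for $x\in(a,b)$ and Dirichlet boundary conditions $u(a,t)=g_a(t)$, $u(b,t)=g_b(t)$ for $t\in(0,T]$, such that $\partial_x^j u$ $(0\le j\le 4)$ and $\partial_t^j u$ $(0\le j\le 3)$ exist and are continuous on $[a,b]\times[0,T]$. For integers $M\ge 1$, $N\ge 0$ and $\tau>0$ with $N\tau\le T$ put $h=(b-a)/M$, $x_{i/2}=a+\tfrac i2h$ $(0\le i\le 2M)$, $t_k=k\tau$, $t_{k-\frac12}=(k-\tfrac12)\tau$. Let $\phi_{j/2}$ $(0\le j\le 2M)$ be the piecewise quadratic Lagrange basis: $\phi_{j/2}$ is continuous on $[a,b]$, is a polynomial of degree at most $2$ on each cell $[x_m,x_{m+1}]$, $0\le m<M$, and $\phi_{j/2}(x_{i/2})=\delta_{ij}$. Put $$d_{i/2}=\int_a^b\frac{dy}{|x_{i/2}-y|^{\gamma}},\qquad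 g_{i,j}=\int_a^b\frac{\phi_{j/2}(y)}{|x_{i/2}-y|^{\gamma}}\,dy,\qquad \mathcal A=\big(d_{i/2}\,\delta_{ij}-g_{i,j}\big)_{i,j=1}^{2M-1},$$ and consider the Crank–Nicolson collocation scheme for the vectors $U^k=(u^k_{i/2})_{i=1}^{2M-1}$, $k=0,\dots,N$: $$u^0_{i/2}=u_0(x_{i/2}),\qquad \Big(I+\frac\tau2\mathcal A\Big)U^k=\Big(I-\frac\tau2\mathcal A\Big)U^{k-1}+\tau F^{k-\frac12}+\tau K^{k-\frac12},\quad 1\le k\le N,$$ where $F^{k-\frac12}_i=f(x_{i/2},t_{k-\frac12})$ and $K^{k-\frac12}_i=g_{i,0}\,g_a(t_{k-\frac12})+g_{i,2M}\,g_b(t_{k-\frac12})$. Then there is a constant $C>0$, which does not depend on $M$, $N$, $\tau$, such that for all $M\ge1$, $N\ge0$ and $\tau>0$ with $N\tau\le T$ the scheme has exactly one solution, and this solution satisfies $$\max_{0\le k\le N}\ \max_{1\le i\le 2M-1}\big|u(x_{i/2},t_k)-u^k_{i/2}\big|\le C\,\big(\tau^2+h^{4-\gamma}\big).$$ -/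

import Mathlib

namespace NonlocalCN

/-- The point `x_s = a + s h` of the uniform mesh of step `h`, for a real index `s`. The mesh nodes
are the `x_{l/2}` with `l = 0, 1, …, 2M`. -/
noncomputable def mesh (a h s : ℝ) : ℝ := a + s * h

/-- The piecewise quadratic Lagrange basis function `φ_{l/2}` of the mesh with nodes `x_{l/2}` and
cells `[x_m, x_{m+1}]`. It belongs to a cell endpoint when `l` is even and to a cell midpoint when
`l` is odd. Only its restriction to `[a, b]` is used, so that `φ_0` and `φ_M` (whose formulas extend
outside `[a, b]`) are the usual one-sided functions there. -/
noncomputable def quadBasis (a h : ℝ) (l : ℕ) (y : ℝ) : ℝ :=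
  let s : ℝ := (l : ℝ) / 2
  if Even l then
    if y ∈ Set.Icc (mesh a h (s - 1)) (mesh a h s) then
      (y - mesh a h (s - 1)) / h * ((2 * y - (mesh a h s + mesh a h (s - 1))) / h)
    else if y ∈ Set.Icc (mesh a h s) (mesh a h (s + 1)) then
      (mesh a h (s + 1) - y) / h * (((mesh a h (s + 1) + mesh a h s) - 2 * y) / h)
    else 0
  else
    if y ∈ Set.Icc (mesh a h (s - 1 / 2)) (mesh a h (s + 1 / 2)) then
      4 * (y - mesh a h (s - 1 / 2)) * (mesh a h (s + 1 / 2) - y) / h ^ 2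
    else 0

/-- The spatial step `h = (b - a) / M`. -/
noncomputable def step (a b : ℝ) (M : ℕ) : ℝ := (b - a) / M

/-- The interior node number `i + 1`, that is `x_{(i+1)/2}`; for `i : Fin (2M - 1)` these are
`x_{1/2}, x_1, …, x_{M-1/2}`. -/
noncomputable def node (a b : ℝ) (M : ℕ) (i : Fin (2 * M - 1)) : ℝ :=
  mesh a (step a b M) (((i : ℕ) + 1 : ℝ) / 2)

/-- `d_{i/2} = ∫_a^b |x_{i/2} - y|^{-γ} dy`. -/
noncomputable def diagCoeff (a b γ : ℝ) (M : ℕ) (i : Fin (2 * M - 1)) : ℝ :=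
  ∫ y in a..b, 1 / |node a b M i - y| ^ γ

/-- `∫_a^b φ_{l/2}(y) |x_{i/2} - y|^{-γ} dy`. -/
noncomputable def weight (a b γ : ℝ) (M : ℕ) (i : Fin (2 * M - 1)) (l : ℕ) : ℝ :=
  ∫ y in a..b, quadBasis a (step a b M) l y / |node a b M i - y| ^ γ

/-- The collocation matrix `A = D - G`, in the natural ordering of the interior nodes. -/
noncomputable def stiffness (a b γ : ℝ) (M : ℕ) :
    Matrix (Fin (2 * M - 1)) (Fin (2 * M - 1)) ℝ :=
  Matrix.diagonal (diagCoeff a b γ M) -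
    Matrix.of fun i (j : Fin (2 * M - 1)) => weight a b γ M i ((j : ℕ) + 1)

/-- The contribution of the boundary values `ua` (at `x = a`) and `ub` (at `x = b`). -/
noncomputable def boundaryVec (a b γ : ℝ) (M : ℕ) (ua ub : ℝ) : Fin (2 * M - 1) → ℝ :=
  fun i => weight a b γ M i 0 * ua + weight a b γ M i (2 * M) * ub

/-- `U` solves the Crank–Nicolson piecewise quadratic collocation scheme with time step `τ`,
source `f`, initial value `u₀` and boundary values `ga`, `gb`:
`(I + τ/2 A) U^{k+1} = (I - τ/2 A) U^k + τ F^{k+1/2} + τ K^{k+1/2}` for `0 ≤ k < N`, where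
`F^{k+1/2}` and `K^{k+1/2}` are taken at the time `t_{k+1/2} = (k + 1/2) τ`. -/
def IsSchemeSolution (a b γ : ℝ) (f : ℝ → ℝ → ℝ) (u₀ ga gb : ℝ → ℝ) (M N : ℕ) (τ : ℝ)
    (U : Fin (N + 1) → Fin (2 * M - 1) → ℝ) : Prop :=
  (∀ i, U 0 i = u₀ (node a b M i)) ∧
  ∀ k : Fin N,
    (1 + (τ / 2) • stiffness a b γ M).mulVec (U k.succ) =
      (1 - (τ / 2) • stiffness a b γ M).mulVec (U k.castSucc)
        + τ • (fun i => f (node a b M i) (((k : ℕ) + 1 / 2 : ℝ) * τ))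
        + τ • boundaryVec a b γ M (ga (((k : ℕ) + 1 / 2 : ℝ) * τ)) (gb (((k : ℕ) + 1 / 2 : ℝ) * τ))

/-- `∂_x^j u` for `j ≤ 4` and `∂_t^j u` for `j ≤ 3` exist and are continuous on the closed rectangle
`[a, b] × [0, T]` (one-sided derivatives at the boundary). -/
structure IsSmooth (a b T : ℝ) (u : ℝ → ℝ → ℝ) : Prop where
  space : ∀ t ∈ Set.Icc 0 T, ContDiffOn ℝ 4 (fun x => u x t) (Set.Icc a b)
  time : ∀ x ∈ Set.Icc a b, ContDiffOn ℝ 3 (fun t => u x t) (Set.Icc 0 T)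
  space_cont : ∀ j ≤ 4, ContinuousOn
    (fun p : ℝ × ℝ => iteratedDerivWithin j (fun x => u x p.2) (Set.Icc a b) p.1)
    (Set.Icc a b ×ˢ Set.Icc 0 T)
  time_cont : ∀ j ≤ 3, ContinuousOn
    (fun p : ℝ × ℝ => iteratedDerivWithin j (fun t => u p.1 t) (Set.Icc 0 T) p.2)
    (Set.Icc a b ×ˢ Set.Icc 0 T)

/-- `u` solves `∂_t u(x,t) + ∫_a^b (u(x,t) - u(y,t)) / |x - y|^γ dy = f(x,t)` on `(a,b) × (0,T]`
with initial value `u₀` and Dirichlet boundary values `ga` at `a` and `gb` at `b`. -/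
structure IsExactSolution (a b T γ : ℝ) (f : ℝ → ℝ → ℝ) (u₀ ga gb : ℝ → ℝ)
    (u : ℝ → ℝ → ℝ) : Prop where
  eqn : ∀ x ∈ Set.Ioo a b, ∀ t ∈ Set.Ioc 0 T,
    derivWithin (fun s => u x s) (Set.Icc 0 T) t + ∫ y in a..b, (u x t - u y t) / |x - y| ^ γ
      = f x t
  initial : ∀ x ∈ Set.Ioo a b, u x 0 = u₀ x
  left : ∀ t ∈ Set.Ioc 0 T, u a t = ga t
  right : ∀ t ∈ Set.Ioc 0 T, u b t = gb t

end NonlocalCN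

/-!
On a cell the interpolation error of `v` is a multiple of the cubic vanishing at the three nodes, up
to `O(h⁴)`. This cubic is odd about the midpoint of the cell and so has mean zero: against a weight
it only sees the oscillation of the weight on the cell. The kernel `|x - y|^{-γ}` truncated at
distance `h` has total variation at most `2 h^{-γ}` and differs from the kernel by `O(h^{1-γ})`
in `L¹`, so the quadrature error is `h³ · h · h^{-γ} + h³ · h^{1-γ} + h⁴ = O(h^{4-γ})`.

The weights `g_{i,j}` are nonnegative: the singularity is the midpoint of a cell or lies outside its
interior, and pairing the points symmetric about the midpoint shows that the positive part of a
basis function wins. They sum to `d_{i/2}` over `j`, because constants are interpolated exactly.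
Hence `I + τ/2 A` obeys a discrete maximum principle: it is invertible and its inverse has norm at
most `1`. Since `A` is bounded uniformly in `M`, the explicit half of a time step costs a factor
`1 + O(τ)`, and a discrete Gronwall argument turns the truncation error `O(τ² + h^{4-γ})` into the
error bound.
-/

open MeasureTheory Set

namespace NonlocalCN

section Kernel

variable {γ h : ℝ}

/-- The singular kernel `|x - y|^{-γ}` of the nonlocal operator; its value at `y = x` is the junk
value `0` when `γ ≠ 0`. -/
noncomputable def kernel (γ x y : ℝ) : ℝ := 1 / |x - y| ^ γ

lemma div_abs_sub_rpow (c x y : ℝ) : c / |x - y| ^ γ = c * kernel γ x y :=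
  div_eq_mul_one_div _ _

lemma kernel_nonneg (x y : ℝ) : 0 ≤ kernel γ x y := by
  unfold kernel
  positivity

lemma kernel_neg_neg (x y : ℝ) : kernel γ (-x) (-y) = kernel γ x y := by
  rw [kernel, kernel, neg_sub_neg, abs_sub_comm]

lemma intervalIntegrable_kernel (hγ : γ < 1) (x c d : ℝ) :
    IntervalIntegrable (kernel γ x) volume c d := by
  have hzero : IntervalIntegrable (kernel γ 0) volume (c - x) (d - x) := by
    refine intervalIntegrable_of_even (fun z => by simp [kernel]) fun z hz => ?_
    refine (intervalIntegral.intervalIntegrable_rpow' (r := -γ) (by linarith)).congr fun y hy => ?_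
    rw [uIoc_of_le hz.le] at hy
    simp only [kernel, zero_sub, abs_neg, abs_of_pos hy.1, Real.rpow_neg hy.1.le, one_div]
  have htranslate : kernel γ x = fun y => kernel γ 0 (y - x) := by
    funext y
    simp [kernel]
  simpa [htranslate] using hzero.comp_sub_right x

lemma integral_kernel_right (hγ : γ < 1) (x : ℝ) {r : ℝ} (hr : 0 ≤ r) :
    ∫ y in x..(x + r), kernel γ x y = r ^ (1 - γ) / (1 - γ) := by
  have hshift : ∫ y in x..(x + r), kernel γ x y = ∫ z in (0 : ℝ)..r, z ^ (-γ) := by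
    rw [← add_zero x, add_assoc, zero_add, ← intervalIntegral.integral_comp_add_left]
    refine intervalIntegral.integral_congr fun z hz => ?_
    rw [uIcc_of_le hr] at hz
    simp [kernel, abs_of_nonneg hz.1, Real.rpow_neg hz.1]
  rw [hshift, integral_rpow (Or.inl (by linarith)), neg_add_eq_sub,
    Real.zero_rpow (by linarith), sub_zero]

lemma integral_kernel_symm (hγ : γ < 1) (x : ℝ) {r : ℝ} (hr : 0 ≤ r) :
    ∫ y in (x - r)..(x + r), kernel γ x y = 2 / (1 - γ) * r ^ (1 - γ) := by
  have hleft : ∫ y in (x - r)..x, kernel γ x y = ∫ y in (-x)..(-x + r), kernel γ (-x) y := by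
    rw [show -x + r = -(x - r) by ring, ← intervalIntegral.integral_comp_neg]
    simp only [kernel_neg_neg]
  rw [← intervalIntegral.integral_add_adjacent_intervals (intervalIntegrable_kernel hγ x _ x)
    (intervalIntegrable_kernel hγ x x _), hleft, integral_kernel_right hγ _ hr,
    integral_kernel_right hγ _ hr]
  ring

lemma integral_kernel_le (hγ : γ < 1) {a b x : ℝ} (hx : x ∈ Icc a b) :
    ∫ y in a..b, kernel γ x y ≤ 2 / (1 - γ) * (b - a) ^ (1 - γ) := by
  have hab : a ≤ b := hx.1.trans hx.2
  rw [← integral_kernel_symm hγ x (sub_nonneg.2 hab)]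
  exact intervalIntegral.integral_mono_interval (by linarith [hx.2]) hab (by linarith [hx.1])
    (Filter.Eventually.of_forall (kernel_nonneg x)) (intervalIntegrable_kernel hγ _ _ _)

/-- The kernel `|x - y|^{-γ}`, frozen at its value `h^{-γ}` for `|x - y| ≤ h`. Unlike the kernel it
has bounded variation. -/
noncomputable def truncKernel (γ h x y : ℝ) : ℝ := 1 / max |x - y| h ^ γ

lemma truncKernel_eq_kernel {x y : ℝ} (hy : h ≤ |x - y|) : truncKernel γ h x y = kernel γ x y := by
  rw [truncKernel, kernel, max_eq_left hy]

lemma truncKernel_self (hh : 0 ≤ h) (x : ℝ) : truncKernel γ h x x = 1 / h ^ γ := by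
  rw [truncKernel, sub_self, abs_zero, max_eq_right hh]

lemma truncKernel_nonneg (hh : 0 ≤ h) (x y : ℝ) : 0 ≤ truncKernel γ h x y := by
  have : 0 ≤ max |x - y| h := le_max_of_le_right hh
  unfold truncKernel
  positivity

lemma continuous_truncKernel (hh : 0 < h) (x : ℝ) : Continuous (truncKernel γ h x) := by
  have hpos : ∀ y : ℝ, 0 < max |x - y| h := fun y => lt_max_of_lt_right hh
  refine continuous_const.div ?_ fun y => (Real.rpow_pos_of_pos (hpos y) γ).ne'
  exact Continuous.rpow_const (by fun_prop) fun y => Or.inl (hpos y).ne'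

lemma truncKernel_anti (hγ : 0 ≤ γ) (hh : 0 < h) {x y z : ℝ} (hyz : |x - y| ≤ |x - z|) :
    truncKernel γ h x z ≤ truncKernel γ h x y := by
  have : 0 < max |x - y| h := lt_max_of_lt_right hh
  unfold truncKernel
  gcongr

lemma truncKernel_le (hγ : 0 ≤ γ) (hh : 0 < h) (x y : ℝ) : truncKernel γ h x y ≤ 1 / h ^ γ := by
  rw [← truncKernel_self hh.le x]
  exact truncKernel_anti hγ hh (by simp)

lemma eVariationOn_neg {s : Set ℝ} (f : ℝ → ℝ) : eVariationOn (-f) s = eVariationOn f s := by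
  simp only [eVariationOn, Pi.neg_apply, edist_neg_neg]

lemma eVariationOn_truncKernel_le (hγ : 0 ≤ γ) (hh : 0 < h) {a b x : ℝ} (hx : x ∈ Icc a b) :
    eVariationOn (truncKernel γ h x) (Icc a b) ≤ ENNReal.ofReal (2 / h ^ γ) := by
  have hmono : MonotoneOn (truncKernel γ h x) (Icc a x) := fun y _ z hz hyz =>
    truncKernel_anti hγ hh (by
      rw [abs_of_nonneg (by linarith [hz.2]), abs_of_nonneg (by linarith [hz.2])]; linarith)
  have hanti : MonotoneOn (-truncKernel γ h x) (Icc x b) := fun y hy z _ hyz =>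
    neg_le_neg <| truncKernel_anti hγ hh (by
      rw [abs_of_nonpos (by linarith [hy.1]), abs_of_nonpos (by linarith [hy.1])]; linarith)
  have hleft := hmono.eVariationOn_eq (left_mem_Icc.2 hx.1) (right_mem_Icc.2 hx.1)
  have hright := hanti.eVariationOn_eq (left_mem_Icc.2 hx.2) (right_mem_Icc.2 hx.2)
  rw [inter_self] at hleft hright
  rw [← Icc_union_Icc_eq_Icc hx.1 hx.2,
    eVariationOn.union _ (isGreatest_Icc hx.1) (isLeast_Icc hx.2),
    ← eVariationOn_neg (s := Icc x b), hleft, hright,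
    show 2 / h ^ γ = 1 / h ^ γ + 1 / h ^ γ by ring,
    ENNReal.ofReal_add (by positivity) (by positivity), Pi.neg_apply, Pi.neg_apply,
    truncKernel_self hh.le]
  gcongr <;> linarith [truncKernel_nonneg (γ := γ) hh.le x a, truncKernel_nonneg (γ := γ) hh.le x b]

lemma abs_kernel_sub_truncKernel_le (hγ : 0 ≤ γ) (hh : 0 < h) (x y : ℝ) :
    |kernel γ x y - truncKernel γ h x y| ≤
      (Ioc (x - h) (x + h)).indicator (fun y => kernel γ x y + 1 / h ^ γ) y := by
  by_cases hy : y ∈ Ioc (x - h) (x + h)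
  · rw [indicator_of_mem hy, abs_le]
    constructor <;> linarith [truncKernel_le hγ hh x y, truncKernel_nonneg (γ := γ) hh.le x y,
      kernel_nonneg (γ := γ) x y]
  · have hfar : h ≤ |x - y| := by
      by_contra! hlt
      rw [abs_lt] at hlt
      exact hy ⟨by linarith, by linarith⟩
    rw [indicator_of_notMem hy, truncKernel_eq_kernel hfar, sub_self, abs_zero]

lemma integral_abs_kernel_sub_truncKernel_le (hγ0 : 0 ≤ γ) (hγ : γ < 1) (hh : 0 < h)
    {a b : ℝ} (hab : a ≤ b) (x : ℝ) :
    ∫ y in a..b, |kernel γ x y - truncKernel γ h x y| ≤ (2 / (1 - γ) + 2) * h ^ (1 - γ) := by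
  have hlocal := abs_kernel_sub_truncKernel_le hγ0 hh x
  have hnear : IntegrableOn (fun y => kernel γ x y + 1 / h ^ γ) (Ioc (x - h) (x + h)) :=
    ((intervalIntegrable_iff_integrableOn_Ioc_of_le (by linarith)).1
      ((intervalIntegrable_kernel hγ x _ _).add (by simp)))
  have hind := hnear.integrable_indicator measurableSet_Ioc
  calc ∫ y in a..b, |kernel γ x y - truncKernel γ h x y|
      ≤ ∫ y in a..b, (Ioc (x - h) (x + h)).indicator (fun y => kernel γ x y + 1 / h ^ γ) y :=
        intervalIntegral.integral_mono hab (((intervalIntegrable_kernel hγ x a b).sub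
          ((continuous_truncKernel hh x).intervalIntegrable a b)).abs)
          hind.intervalIntegrable hlocal
    _ ≤ ∫ y, (Ioc (x - h) (x + h)).indicator (fun y => kernel γ x y + 1 / h ^ γ) y := by
        rw [intervalIntegral.integral_of_le hab]
        exact setIntegral_le_integral hind
          (Filter.Eventually.of_forall fun y => (abs_nonneg _).trans (hlocal y))
    _ = ∫ y in (x - h)..(x + h), (kernel γ x y + 1 / h ^ γ) := by
        rw [integral_indicator measurableSet_Ioc, intervalIntegral.integral_of_le (by linarith)]
    _ = (2 / (1 - γ) + 2) * h ^ (1 - γ) := by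
        rw [intervalIntegral.integral_add (intervalIntegrable_kernel hγ x _ _) (by simp),
          integral_kernel_symm hγ x hh.le, intervalIntegral.integral_const, Real.rpow_sub hh,
          Real.rpow_one, smul_eq_mul]
        ring

end Kernel

section Taylor

lemma abs_le_mul_abs_sub_pow_succ {p q c K : ℝ} {n : ℕ} {g g' : ℝ → ℝ} (hK : 0 ≤ K)
    (hg : ∀ x ∈ Icc p q, HasDerivWithinAt g (g' x) (Icc p q) x) (hc : c ∈ Icc p q) (hgc : g c = 0)
    (hg' : ∀ x ∈ Icc p q, |g' x| ≤ K * |x - c| ^ n) {y : ℝ} (hy : y ∈ Icc p q) :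
    |g y| ≤ K * |y - c| ^ (n + 1) := by
  have hsub : uIcc c y ⊆ Icc p q := ordConnected_Icc.uIcc_subset hc hy
  have hbound : ∀ z ∈ uIcc c y, ‖g' z‖ ≤ K * |y - c| ^ n := fun z hz => by
    refine (hg' z (hsub hz)).trans ?_
    gcongr ?_ * ?_ ^ n
    exact abs_sub_left_of_mem_uIcc hz
  have hmvt := (convex_uIcc c y).norm_image_sub_le_of_norm_hasDerivWithin_le
    (fun z hz => (hg z (hsub hz)).mono hsub) hbound left_mem_uIcc right_mem_uIcc
  rwa [hgc, sub_zero, mul_assoc, Real.norm_eq_abs, Real.norm_eq_abs, ← pow_succ] at hmvt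

lemma abs_sub_taylorWithinEval_le {p q c K : ℝ} (hpq : p < q) (hc : c ∈ Icc p q) {n : ℕ}
    {f : ℝ → ℝ} (hf : ContDiffOn ℝ (n + 1) f (Icc p q))
    (hK : ∀ x ∈ Icc p q, |iteratedDerivWithin (n + 1) f (Icc p q) x| ≤ K) {y : ℝ}
    (hy : y ∈ Icc p q) :
    |f y - taylorWithinEval f n (Icc p q) c y| ≤ K * |y - c| ^ (n + 1) := by
  have hK0 : 0 ≤ K := (abs_nonneg _).trans (hK c hc)
  have hderiv : ∀ x ∈ Icc p q, HasDerivWithinAt f (derivWithin f (Icc p q) x) (Icc p q) x :=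
    fun x hx => (hf.differentiableOn (by simp) x hx).hasDerivWithinAt
  induction n generalizing f y with
  | zero =>
    simp only [taylor_within_zero_eval]
    exact abs_le_mul_abs_sub_pow_succ hK0 (fun x hx => (hderiv x hx).sub_const (f c)) hc
      (sub_self _) (fun x hx => by simpa using hK x hx) hy
  | succ n ih =>
    have hf' : ContDiffOn ℝ (n + 1) (derivWithin f (Icc p q)) (Icc p q) :=
      hf.derivWithin (uniqueDiffOn_Icc hpq) (by norm_cast)
    refine abs_le_mul_abs_sub_pow_succ hK0 (fun x hx => (hderiv x hx).sub
      (hasDerivAt_taylorWithinEval_succ f n).hasDerivWithinAt) hc (by simp) (fun x hx => ?_) hy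
    refine ih hf' (fun z hz => ?_) hx fun z hz =>
      (hf'.differentiableOn (by simp) z hz).hasDerivWithinAt
    rw [← iteratedDerivWithin_succ']
    exact hK z hz

lemma abs_central_difference_sub_le {p q t δ K : ℝ} (hδ : 0 < δ) (ht : p ≤ t - δ)
    (ht' : t + δ ≤ q) {f : ℝ → ℝ} (hf : ContDiffOn ℝ 3 f (Icc p q))
    (hK : ∀ x ∈ Icc p q, |iteratedDerivWithin 3 f (Icc p q) x| ≤ K) :
    |f (t + δ) - f (t - δ) - 2 * δ * derivWithin f (Icc p q) t| ≤ 2 * K * δ ^ 3 := by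
  set R : ℝ → ℝ := fun y => f y - taylorWithinEval f 2 (Icc p q) t y with hR
  have hRle : ∀ y ∈ Icc p q, |R y| ≤ K * |y - t| ^ 3 := fun y hy =>
    abs_sub_taylorWithinEval_le (by linarith) ⟨by linarith, by linarith⟩ hf hK hy
  have hright : |R (t + δ)| ≤ K * δ ^ 3 := by
    simpa [abs_of_pos hδ] using hRle (t + δ) ⟨by linarith, ht'⟩
  have hleft : |R (t - δ)| ≤ K * δ ^ 3 := by
    simpa [abs_of_pos hδ] using hRle (t - δ) ⟨ht, by linarith⟩
  calc |f (t + δ) - f (t - δ) - 2 * δ * derivWithin f (Icc p q) t| = |R (t + δ) - R (t - δ)| := by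
        simp only [hR, taylorWithinEval_succ, taylor_within_zero_eval, zero_add,
          iteratedDerivWithin_one, smul_eq_mul]
        push_cast
        ring_nf
    _ ≤ K * δ ^ 3 + K * δ ^ 3 := (abs_sub _ _).trans (add_le_add hright hleft)
    _ = 2 * K * δ ^ 3 := by ring

lemma abs_average_sub_le {p q t δ K : ℝ} (hδ : 0 < δ) (ht : p ≤ t - δ)
    (ht' : t + δ ≤ q) {f : ℝ → ℝ} (hf : ContDiffOn ℝ 2 f (Icc p q))
    (hK : ∀ x ∈ Icc p q, |iteratedDerivWithin 2 f (Icc p q) x| ≤ K) :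
    |(f (t + δ) + f (t - δ)) / 2 - f t| ≤ K * δ ^ 2 := by
  set R : ℝ → ℝ := fun y => f y - taylorWithinEval f 1 (Icc p q) t y with hR
  have hRle : ∀ y ∈ Icc p q, |R y| ≤ K * |y - t| ^ 2 := fun y hy =>
    abs_sub_taylorWithinEval_le (by linarith) ⟨by linarith, by linarith⟩ hf hK hy
  have hright : |R (t + δ)| ≤ K * δ ^ 2 := by
    simpa [abs_of_pos hδ] using hRle (t + δ) ⟨by linarith, ht'⟩
  have hleft : |R (t - δ)| ≤ K * δ ^ 2 := by
    simpa [abs_of_pos hδ] using hRle (t - δ) ⟨ht, by linarith⟩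
  calc |(f (t + δ) + f (t - δ)) / 2 - f t| = |(R (t + δ) + R (t - δ)) / 2| := by
        simp only [hR, taylorWithinEval_succ, taylor_within_zero_eval, zero_add,
          iteratedDerivWithin_one, smul_eq_mul]
        push_cast
        ring_nf
    _ ≤ (K * δ ^ 2 + K * δ ^ 2) / 2 := by
        rw [abs_div, abs_two]
        gcongr
        exact (abs_add_le _ _).trans (add_le_add hright hleft)
    _ = K * δ ^ 2 := by ring

/-- The quadratic polynomial in `y` that interpolates `f` at `c - r`, `c` and `c + r`. -/
noncomputable def quadLagrange (f : ℝ → ℝ) (c r y : ℝ) : ℝ :=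
  f (c - r) * ((y - c) * (y - c - r) / (2 * r ^ 2)) + f c * ((r ^ 2 - (y - c) ^ 2) / r ^ 2)
    + f (c + r) * ((y - c) * (y - c + r) / (2 * r ^ 2))

/-- The monic cubic in `y` that vanishes at `c - r`, `c` and `c + r`, to which the leading error
term of quadratic interpolation at these nodes is proportional. -/
def nodeCubic (c r y : ℝ) : ℝ := (y - c) ^ 3 - r ^ 2 * (y - c)

lemma abs_mul_add_div_two_mul_sq_le_one {r s σ : ℝ} (hs : |s| ≤ r) (hσ : |σ| ≤ r) :
    |s * (s + σ) / (2 * r ^ 2)| ≤ 1 := by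
  have hr : 0 ≤ r := (abs_nonneg s).trans hs
  rw [abs_div, abs_of_nonneg (show 0 ≤ 2 * r ^ 2 by positivity), abs_mul]
  refine div_le_one_of_le₀ ?_ (by positivity)
  calc |s| * |s + σ| ≤ r * (r + r) := by
        gcongr
        exact (abs_add_le _ _).trans (add_le_add hs hσ)
    _ = 2 * r ^ 2 := by ring

lemma abs_sub_quadLagrange_sub_nodeCubic_le {p q c r K : ℝ} (hr : 0 < r) (hp : p ≤ c - r)
    (hq : c + r ≤ q) {f : ℝ → ℝ} (hf : ContDiffOn ℝ 4 f (Icc p q))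
    (hK : ∀ x ∈ Icc p q, |iteratedDerivWithin 4 f (Icc p q) x| ≤ K) {y : ℝ} (hy : |y - c| ≤ r) :
    |f y - quadLagrange f c r y - iteratedDerivWithin 3 f (Icc p q) c / 6 * nodeCubic c r y| ≤
      3 * K * r ^ 4 := by
  have hc : c ∈ Icc p q := ⟨by linarith, by linarith⟩
  have hK0 : 0 ≤ K := (abs_nonneg _).trans (hK c hc)
  set R : ℝ → ℝ := fun z => f z - taylorWithinEval f 3 (Icc p q) c z with hR
  have hRle : ∀ z, |z - c| ≤ r → |R z| ≤ K * r ^ 4 := fun z hz => by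
    have hz' := abs_le.1 hz
    refine (abs_sub_taylorWithinEval_le (by linarith) hc hf hK
      ⟨by linarith, by linarith⟩).trans ?_
    gcongr
  have hsplit : f y - quadLagrange f c r y
      - iteratedDerivWithin 3 f (Icc p q) c / 6 * nodeCubic c r y =
      R y - R (c - r) * ((y - c) * (y - c + -r) / (2 * r ^ 2))
        - R (c + r) * ((y - c) * (y - c + r) / (2 * r ^ 2)) := by
    simp only [hR, quadLagrange, nodeCubic, taylorWithinEval_succ, taylor_within_zero_eval,
      smul_eq_mul, Nat.factorial]
    push_cast
    field_simp
    ring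
  have hweighted : ∀ σ, |σ| ≤ r →
      |R (c + σ) * ((y - c) * (y - c + σ) / (2 * r ^ 2))| ≤ K * r ^ 4 := fun σ hσ => by
    rw [abs_mul]
    exact mul_le_of_le_one_right (abs_nonneg _) (abs_mul_add_div_two_mul_sq_le_one hy hσ) |>.trans
      (hRle _ (by simpa using hσ))
  have hleft := hweighted (-r) (by simp [abs_of_pos hr])
  have hright := hweighted r (abs_of_pos hr).le
  rw [hsplit, sub_eq_add_neg c r]
  exact ((abs_sub _ _).trans (add_le_add ((abs_sub _ _).trans (add_le_add (hRle y hy) hleft))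
    hright)).trans_eq (by ring)

lemma abs_nodeCubic_le {c r y : ℝ} (hy : |y - c| ≤ r) : |nodeCubic c r y| ≤ r ^ 3 := by
  have hsq : (y - c) ^ 2 ≤ r ^ 2 := sq_le_sq' (abs_le.1 hy).1 (abs_le.1 hy).2
  calc |nodeCubic c r y| = |y - c| * (r ^ 2 - (y - c) ^ 2) := by
        rw [nodeCubic, ← abs_of_nonneg (sub_nonneg.2 hsq), ← abs_mul, ← abs_neg]
        ring_nf
    _ ≤ r * r ^ 2 := by
        gcongr
        · exact (abs_nonneg _).trans hy
        · linarith [sq_nonneg (y - c)]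
    _ = r ^ 3 := by ring

lemma integral_nodeCubic (c r : ℝ) : ∫ y in (c - r)..(c + r), nodeCubic c r y = 0 := by
  simp only [nodeCubic]
  rw [intervalIntegral.integral_comp_sub_right (fun s => s ^ 3 - r ^ 2 * s) c,
    intervalIntegral.integral_sub (by simp) (Continuous.intervalIntegrable (by fun_prop) _ _),
    integral_pow, intervalIntegral.integral_const_mul, integral_id]
  push_cast
  ring

end Taylor

section Basis

variable {a h : ℝ}

/-- The midpoint `x_{m + 1/2}` of the cell `[x_m, x_{m+1}]`. -/
noncomputable def cellMid (a h : ℝ) (m : ℕ) : ℝ := mesh a h (m + 1 / 2)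

lemma cellMid_sub_half (a h : ℝ) (m : ℕ) : cellMid a h m - h / 2 = mesh a h m := by
  unfold cellMid mesh
  ring

lemma cellMid_add_half (a h : ℝ) (m : ℕ) : cellMid a h m + h / 2 = mesh a h (m + 1) := by
  unfold cellMid mesh
  ring

lemma mesh_zero (a h : ℝ) : mesh a h 0 = a := by simp [mesh]

lemma mesh_strictMono (hh : 0 < h) : StrictMono (mesh a h) := fun s t hst => by
  unfold mesh
  gcongr

lemma quadBasis_even {m : ℕ} {y : ℝ} (hy : |y - cellMid a h m| < h / 2) :
    quadBasis a h (2 * m) y =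
      (y - cellMid a h m) * (y - cellMid a h m - h / 2) / (2 * (h / 2) ^ 2) := by
  have hindex : ((2 * m : ℕ) : ℝ) / 2 = m := by push_cast; ring
  have hh : 0 < h := by linarith [abs_nonneg (y - cellMid a h m)]
  rw [abs_lt] at hy
  have hleft : mesh a h m < y := by linarith [cellMid_sub_half a h m]
  have hright : y < mesh a h (m + 1) := by linarith [cellMid_add_half a h m]
  simp only [quadBasis, hindex]
  rw [if_pos (even_two_mul m), if_neg fun hmem => absurd hmem.2 hleft.not_ge,
    if_pos ⟨hleft.le, hright.le⟩, cellMid, mesh, mesh, mesh]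
  field_simp
  ring

lemma quadBasis_odd {m : ℕ} {y : ℝ} (hy : |y - cellMid a h m| < h / 2) :
    quadBasis a h (2 * m + 1) y = ((h / 2) ^ 2 - (y - cellMid a h m) ^ 2) / (h / 2) ^ 2 := by
  have hindex : ((2 * m + 1 : ℕ) : ℝ) / 2 = m + 1 / 2 := by push_cast; ring
  have hh : 0 < h := by linarith [abs_nonneg (y - cellMid a h m)]
  rw [abs_lt] at hy
  simp only [quadBasis, hindex]
  rw [add_sub_cancel_right, show (m : ℝ) + 1 / 2 + 1 / 2 = m + 1 by ring, ← cellMid_sub_half,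
    ← cellMid_add_half, if_neg (by simp), if_pos ⟨by linarith, by linarith⟩]
  field_simp
  ring

lemma quadBasis_even_succ {m : ℕ} {y : ℝ} (hy : |y - cellMid a h m| < h / 2) :
    quadBasis a h (2 * m + 2) y =
      (y - cellMid a h m) * (y - cellMid a h m + h / 2) / (2 * (h / 2) ^ 2) := by
  have hindex : ((2 * m + 2 : ℕ) : ℝ) / 2 = m + 1 := by push_cast; ring
  have hh : 0 < h := by linarith [abs_nonneg (y - cellMid a h m)]
  rw [abs_lt] at hy
  simp only [quadBasis, hindex]
  rw [add_sub_cancel_right, if_pos (by simp [parity_simps]), ← cellMid_sub_half,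
    ← cellMid_add_half, if_pos ⟨by linarith, by linarith⟩]
  field_simp
  ring

lemma quadBasis_eq_zero {m l : ℕ} {y : ℝ} (hy : |y - cellMid a h m| < h / 2)
    (hl : l ∉ Finset.Icc (2 * m) (2 * m + 2)) : quadBasis a h l y = 0 := by
  have hh : 0 < h := by linarith [abs_nonneg (y - cellMid a h m)]
  rw [abs_lt] at hy
  have hleft : mesh a h m < y := by linarith [cellMid_sub_half a h m]
  have hright : y < mesh a h (m + 1) := by linarith [cellMid_add_half a h m]
  have hmeet : ∀ {s t : ℝ}, y ∈ Icc (mesh a h s) (mesh a h t) → s < m + 1 ∧ (m : ℝ) < t :=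
    fun hst => ⟨(mesh_strictMono hh).lt_iff_lt.1 (hst.1.trans_lt hright),
      (mesh_strictMono hh).lt_iff_lt.1 (hleft.trans_le hst.2)⟩
  have hfar : (l : ℝ) + 1 ≤ 2 * m ∨ 2 * (m : ℝ) + 3 ≤ l := by
    rw [Finset.mem_Icc] at hl
    exact_mod_cast (by omega : l + 1 ≤ 2 * m ∨ 2 * m + 3 ≤ l)
  have heven : Even l → (l : ℝ) + 2 ≤ 2 * m ∨ 2 * (m : ℝ) + 4 ≤ l := by
    rintro ⟨j, rfl⟩
    rw [Finset.mem_Icc] at hl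
    exact_mod_cast (by omega : j + j + 2 ≤ 2 * m ∨ 2 * m + 4 ≤ j + j)
  simp only [quadBasis]
  split_ifs with hl_even hy_left hy_right hy_mid
  · obtain ⟨hlt, hgt⟩ := hmeet hy_left
    rcases heven hl_even with h' | h' <;> linarith
  · obtain ⟨hlt, hgt⟩ := hmeet hy_right
    rcases heven hl_even with h' | h' <;> linarith
  · rfl
  · obtain ⟨hlt, hgt⟩ := hmeet hy_mid
    rcases hfar with h' | h' <;> linarith
  · rfl

lemma measurable_quadBasis (a h : ℝ) (l : ℕ) : Measurable (quadBasis a h l) := by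
  unfold quadBasis
  simp only
  split_ifs
  · exact Measurable.ite measurableSet_Icc (by fun_prop)
      (Measurable.ite measurableSet_Icc (by fun_prop) measurable_const)
  · exact Measurable.ite measurableSet_Icc (by fun_prop) measurable_const

lemma abs_quadBasis_le_one (hh : 0 < h) (l : ℕ) (y : ℝ) : |quadBasis a h l y| ≤ 1 := by
  have hend : ∀ {s : ℝ}, 0 ≤ s → s ≤ h → |s / h * ((2 * s - h) / h)| ≤ 1 := by
    intro s hs0 hs1
    rw [abs_mul]
    refine mul_le_one₀ ?_ (abs_nonneg _) ?_ <;> rw [abs_div, abs_of_pos hh, div_le_one hh, abs_le]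
    all_goals constructor <;> linarith
  unfold quadBasis mesh
  simp only
  split_ifs with _ hleft hright hmid
  · convert hend (sub_nonneg.2 hleft.1) (by linarith [hleft.2]) using 4
    ring
  · convert hend (sub_nonneg.2 hright.2) (by linarith [hright.1]) using 4
    ring
  · simp
  · obtain ⟨hmid_left, hmid_right⟩ := hmid
    rw [abs_div, abs_of_pos (pow_pos hh 2), div_le_one (pow_pos hh 2), abs_le]
    constructor <;> nlinarith [sq_nonneg (y - (a + l / 2 * h))]
  · simp

lemma intervalIntegrable_quadBasis_mul (hh : 0 < h) (l : ℕ) {c d : ℝ} {w : ℝ → ℝ}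
    (hw : IntervalIntegrable w volume c d) :
    IntervalIntegrable (fun y => quadBasis a h l y * w y) volume c d := by
  refine hw.mono_fun
    ((measurable_quadBasis a h l).aestronglyMeasurable.mul hw.def'.aestronglyMeasurable)
    (Filter.Eventually.of_forall fun y => ?_)
  simp only [norm_mul]
  exact mul_le_of_le_one_left (norm_nonneg _) (abs_quadBasis_le_one hh l y)

/-- The continuous piecewise quadratic function that interpolates `v` at the nodes `x_{l/2}`,
`0 ≤ l ≤ 2M`. -/
noncomputable def quadInterp (a h : ℝ) (M : ℕ) (v : ℝ → ℝ) (y : ℝ) : ℝ :=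
  ∑ l ∈ Finset.range (2 * M + 1), v (mesh a h (l / 2)) * quadBasis a h l y

lemma quadInterp_eq_quadLagrange {M m : ℕ} (hm : m < M) (v : ℝ → ℝ) {y : ℝ}
    (hy : |y - cellMid a h m| < h / 2) :
    quadInterp a h M v y = quadLagrange v (cellMid a h m) (h / 2) y := by
  have hsub : Finset.Icc (2 * m) (2 * m + 2) ⊆ Finset.range (2 * M + 1) := by
    intro l hl
    rw [Finset.mem_Icc] at hl
    rw [Finset.mem_range]
    omega
  have hindex : ((2 * m : ℕ) : ℝ) / 2 = m ∧ ((2 * m + 1 : ℕ) : ℝ) / 2 = m + 1 / 2 ∧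
      ((2 * m + 2 : ℕ) : ℝ) / 2 = m + 1 := by
    push_cast
    refine ⟨?_, ?_, ?_⟩ <;> ring
  rw [quadInterp, ← Finset.sum_subset hsub fun l _ hl => by rw [quadBasis_eq_zero hy hl, mul_zero],
    Finset.sum_Icc_succ_top (by omega), Finset.sum_Icc_succ_top (by omega), Finset.Icc_self,
    Finset.sum_singleton, quadBasis_even hy, quadBasis_odd hy, quadBasis_even_succ hy,
    hindex.1, hindex.2.1, hindex.2.2, quadLagrange, cellMid_sub_half, cellMid_add_half, cellMid]

lemma intervalIntegrable_quadInterp_mul (hh : 0 < h) (M : ℕ) (v : ℝ → ℝ) {c d : ℝ} {w : ℝ → ℝ}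
    (hw : IntervalIntegrable w volume c d) :
    IntervalIntegrable (fun y => quadInterp a h M v y * w y) volume c d := by
  simp only [quadInterp, Finset.sum_mul, mul_assoc]
  simpa only [Finset.sum_fn] using IntervalIntegrable.sum _ fun l _ =>
    (intervalIntegrable_quadBasis_mul (a := a) hh l hw).const_mul (v (mesh a h (l / 2)))

lemma integral_quadInterp_mul (hh : 0 < h) (M : ℕ) (v : ℝ → ℝ) {c d : ℝ} {w : ℝ → ℝ}
    (hw : IntervalIntegrable w volume c d) :
    ∫ y in c..d, quadInterp a h M v y * w y =
      ∑ l ∈ Finset.range (2 * M + 1),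
        v (mesh a h (l / 2)) * ∫ y in c..d, quadBasis a h l y * w y := by
  simp only [quadInterp, Finset.sum_mul, mul_assoc]
  rw [intervalIntegral.integral_finsetSum fun l _ =>
    (intervalIntegrable_quadBasis_mul hh l hw).const_mul _]
  simp only [intervalIntegral.integral_const_mul]

lemma cell_subset (hh : 0 < h) {M m : ℕ} (hm : m < M) :
    Icc (cellMid a h m - h / 2) (cellMid a h m + h / 2) ⊆ Icc a (mesh a h M) := by
  have hmono := (mesh_strictMono (a := a) hh).monotone
  rw [cellMid_sub_half, cellMid_add_half]
  refine Icc_subset_Icc ?_ (hmono (by exact_mod_cast hm))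
  simpa only [mesh_zero] using hmono m.cast_nonneg

lemma sum_integral_cells (hh : 0 < h) {M : ℕ} {g : ℝ → ℝ}
    (hg : IntervalIntegrable g volume a (mesh a h M)) :
    ∑ m ∈ Finset.range M, ∫ y in (cellMid a h m - h / 2)..(cellMid a h m + h / 2), g y =
      ∫ y in a..(mesh a h M), g y := by
  have hcell : ∀ m < M, IntervalIntegrable g volume (mesh a h m) (mesh a h (m + 1 : ℕ)) := by
    intro m hm
    refine hg.mono_set ?_
    rw [Nat.cast_succ, ← cellMid_sub_half, ← cellMid_add_half, uIcc_of_le (by linarith)]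
    exact (cell_subset hh hm).trans Icc_subset_uIcc
  have hsum := intervalIntegral.sum_integral_adjacent_intervals hcell
  simpa only [Nat.cast_succ, Nat.cast_zero, mesh_zero, cellMid_sub_half, cellMid_add_half]
    using hsum

end Basis

section Quadrature

lemma abs_mul_sub_mul_le {e w p k k₀ B P V : ℝ} (hw : 0 ≤ w) (he : |e - p| ≤ B) (hp : |p| ≤ P)
    (hk : |k - k₀| ≤ V) : |e * w - p * k₀| ≤ B * w + P * |w - k| + P * V := by
  have hP : 0 ≤ P := (abs_nonneg p).trans hp
  calc |e * w - p * k₀| = |(e - p) * w + p * (w - k) + p * (k - k₀)| := by ring_nf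
    _ ≤ |e - p| * w + |p| * |w - k| + |p| * |k - k₀| := by
        refine (abs_add_three _ _ _).trans_eq ?_
        rw [abs_mul, abs_mul p, abs_mul p, abs_of_nonneg hw]
    _ ≤ B * w + P * |w - k| + P * V := by gcongr

-- The part `κ * k c * nodeCubic` of the integrand has integral zero, so that only the oscillation
-- of the weight on the cell meets the cubic.
lemma abs_integral_mul_le_of_abs_sub_nodeCubic_le {c r κ K B V : ℝ} (hr : 0 ≤ r) {e w k : ℝ → ℝ}
    (hw : IntervalIntegrable w volume (c - r) (c + r)) (hw_nonneg : ∀ y, 0 ≤ w y)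
    (hk : IntervalIntegrable k volume (c - r) (c + r))
    (he : IntervalIntegrable (fun y => e y * w y) volume (c - r) (c + r)) (hκ : |κ| ≤ K)
    (hB : ∀ y, |y - c| < r → |e y - κ * nodeCubic c r y| ≤ B)
    (hV : ∀ y, |y - c| < r → |k y - k c| ≤ V) :
    |∫ y in (c - r)..(c + r), e y * w y| ≤
      B * (∫ y in (c - r)..(c + r), w y) + K * r ^ 3 * (∫ y in (c - r)..(c + r), |w y - k y|)
        + 2 * K * r ^ 4 * V := by
  have hcubic : IntervalIntegrable (fun y => κ * k c * nodeCubic c r y) volume (c - r) (c + r) := by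
    unfold nodeCubic
    exact Continuous.intervalIntegrable (by fun_prop) _ _
  have hshift : ∫ y in (c - r)..(c + r), e y * w y =
      ∫ y in (c - r)..(c + r), (e y * w y - κ * k c * nodeCubic c r y) := by
    rw [intervalIntegral.integral_sub he hcubic, intervalIntegral.integral_const_mul,
      integral_nodeCubic, mul_zero, sub_zero]
  have hbound : ∀ y ∈ Ioo (c - r) (c + r), ‖e y * w y - κ * k c * nodeCubic c r y‖ ≤
      B * w y + K * r ^ 3 * |w y - k y| + K * r ^ 3 * V := by
    intro y hy
    have hyr : |y - c| < r := abs_lt.2 ⟨by linarith [hy.1], by linarith [hy.2]⟩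
    rw [Real.norm_eq_abs, mul_right_comm]
    refine abs_mul_sub_mul_le (hw_nonneg y) (hB y hyr) ?_ (hV y hyr)
    rw [abs_mul]
    exact mul_le_mul hκ (abs_nodeCubic_le hyr.le) (abs_nonneg _) ((abs_nonneg κ).trans hκ)
  have hw_int := hw.const_mul B
  have hwk_int := (hw.sub hk).abs.const_mul (K * r ^ 3)
  rw [hshift, ← Real.norm_eq_abs]
  calc ‖∫ y in (c - r)..(c + r), (e y * w y - κ * k c * nodeCubic c r y)‖
      ≤ ∫ y in (c - r)..(c + r), (B * w y + K * r ^ 3 * |w y - k y| + K * r ^ 3 * V) := by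
        refine intervalIntegral.norm_integral_le_of_norm_le (by linarith) ?_
          ((hw_int.add hwk_int).add intervalIntegrable_const)
        filter_upwards [Measure.ae_ne volume (c + r)] with y hy_ne hy
        exact hbound y ⟨hy.1, lt_of_le_of_ne hy.2 hy_ne⟩
    _ = _ := by
        rw [intervalIntegral.integral_add (hw_int.add hwk_int) intervalIntegrable_const,
          intervalIntegral.integral_add hw_int hwk_int, intervalIntegral.integral_const_mul,
          intervalIntegral.integral_const_mul, intervalIntegral.integral_const, smul_eq_mul]
        ring

variable {a h : ℝ}

lemma sum_eVariationOn_cells (hh : 0 < h) (M : ℕ) (k : ℝ → ℝ) :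
    ∑ m ∈ Finset.range M,
        eVariationOn k (Icc (cellMid a h m - h / 2) (cellMid a h m + h / 2)) =
      eVariationOn k (Icc a (mesh a h M)) := by
  have hmono : Monotone fun m : ℕ => mesh a h m :=
    (mesh_strictMono hh).monotone.comp Nat.mono_cast
  have hsum := eVariationOn.sum' k hmono (n := M)
  simpa only [Nat.cast_succ, Nat.cast_zero, mesh_zero, cellMid_sub_half, cellMid_add_half]
    using hsum

variable {M : ℕ} {K₃ K₄ : ℝ} {v w k : ℝ → ℝ}

lemma abs_integral_cell_sub_quadInterp_mul_le (hh : 0 < h)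
    (hv : ContDiffOn ℝ 4 v (Icc a (mesh a h M)))
    (h3 : ∀ x ∈ Icc a (mesh a h M), |iteratedDerivWithin 3 v (Icc a (mesh a h M)) x| ≤ K₃)
    (h4 : ∀ x ∈ Icc a (mesh a h M), |iteratedDerivWithin 4 v (Icc a (mesh a h M)) x| ≤ K₄)
    (hw : IntervalIntegrable w volume a (mesh a h M)) (hw_nonneg : ∀ y, 0 ≤ w y)
    (hk : IntervalIntegrable k volume a (mesh a h M))
    (hk_var : BoundedVariationOn k (Icc a (mesh a h M))) {m : ℕ} (hm : m < M) :
    |∫ y in (cellMid a h m - h / 2)..(cellMid a h m + h / 2),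
        (v y - quadInterp a h M v y) * w y| ≤
      3 * K₄ * (h / 2) ^ 4 * (∫ y in (cellMid a h m - h / 2)..(cellMid a h m + h / 2), w y)
        + K₃ * (h / 2) ^ 3 *
          (∫ y in (cellMid a h m - h / 2)..(cellMid a h m + h / 2), |w y - k y|)
        + 2 * K₃ * (h / 2) ^ 4 *
          (eVariationOn k (Icc (cellMid a h m - h / 2) (cellMid a h m + h / 2))).toReal := by
  have hcell := cell_subset (a := a) hh hm
  set c := cellMid a h m
  have hcell_le : c - h / 2 ≤ c + h / 2 := by linarith
  have huIcc : uIcc (c - h / 2) (c + h / 2) ⊆ uIcc a (mesh a h M) := by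
    rw [uIcc_of_le hcell_le]
    exact hcell.trans Icc_subset_uIcc
  have hc : c ∈ Icc (c - h / 2) (c + h / 2) := ⟨by linarith, by linarith⟩
  have hv_int : IntervalIntegrable (fun y => (v y - quadInterp a h M v y) * w y) volume
      (c - h / 2) (c + h / 2) := by
    have hvw : IntervalIntegrable (fun y => v y * w y) volume (c - h / 2) (c + h / 2) :=
      (hw.mono_set huIcc).continuousOn_mul
        (hv.continuousOn.mono (by rw [uIcc_of_le hcell_le]; exact hcell))
    simpa only [sub_mul] using
      hvw.sub (intervalIntegrable_quadInterp_mul hh M v (hw.mono_set huIcc))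
  refine abs_integral_mul_le_of_abs_sub_nodeCubic_le
    (κ := iteratedDerivWithin 3 v (Icc a (mesh a h M)) c / 6) (by linarith) (hw.mono_set huIcc)
    hw_nonneg (hk.mono_set huIcc) hv_int ?_ (fun y hy => ?_) fun y hy => ?_
  · rw [abs_div, abs_of_pos (by norm_num : (0 : ℝ) < 6)]
    linarith [h3 c (hcell hc), abs_nonneg (iteratedDerivWithin 3 v (Icc a (mesh a h M)) c)]
  · rw [quadInterp_eq_quadLagrange hm v hy]
    exact abs_sub_quadLagrange_sub_nodeCubic_le (by linarith) (hcell (left_mem_Icc.2 hcell_le)).1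
      (hcell (right_mem_Icc.2 hcell_le)).2 hv h4 hy.le
  · rw [abs_lt] at hy
    exact (hk_var.mono hcell).dist_le ⟨by linarith, by linarith⟩ hc

lemma abs_integral_sub_quadInterp_mul_le (hh : 0 < h)
    (hv : ContDiffOn ℝ 4 v (Icc a (mesh a h M)))
    (h3 : ∀ x ∈ Icc a (mesh a h M), |iteratedDerivWithin 3 v (Icc a (mesh a h M)) x| ≤ K₃)
    (h4 : ∀ x ∈ Icc a (mesh a h M), |iteratedDerivWithin 4 v (Icc a (mesh a h M)) x| ≤ K₄)
    (hw : IntervalIntegrable w volume a (mesh a h M)) (hw_nonneg : ∀ y, 0 ≤ w y)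
    (hk : IntervalIntegrable k volume a (mesh a h M))
    (hk_var : BoundedVariationOn k (Icc a (mesh a h M))) :
    |(∫ y in a..(mesh a h M), v y * w y) - ∫ y in a..(mesh a h M), quadInterp a h M v y * w y| ≤
      3 * K₄ * (h / 2) ^ 4 * (∫ y in a..(mesh a h M), w y)
        + K₃ * (h / 2) ^ 3 * (∫ y in a..(mesh a h M), |w y - k y|)
        + 2 * K₃ * (h / 2) ^ 4 * (eVariationOn k (Icc a (mesh a h M))).toReal := by
  have hab : a ≤ mesh a h M := by
    simpa only [mesh_zero] using (mesh_strictMono (a := a) hh).monotone M.cast_nonneg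
  have hvw : IntervalIntegrable (fun y => v y * w y) volume a (mesh a h M) :=
    hw.continuousOn_mul (by rw [uIcc_of_le hab]; exact hv.continuousOn)
  have hInterp := intervalIntegrable_quadInterp_mul (a := a) hh M v hw
  have hsub_int := hvw.sub hInterp
  rw [← intervalIntegral.integral_sub hvw hInterp, ← sum_integral_cells hh hsub_int,
    ← sum_integral_cells hh hw, ← sum_integral_cells hh (hw.sub hk).abs,
    ← sum_eVariationOn_cells hh M, ENNReal.toReal_sum fun m hm =>
      hk_var.mono (cell_subset hh (Finset.mem_range.1 hm)), Finset.mul_sum, Finset.mul_sum,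
    Finset.mul_sum, ← Finset.sum_add_distrib, ← Finset.sum_add_distrib]
  refine (Finset.abs_sum_le_sum_abs _ _).trans (Finset.sum_le_sum fun m hm => ?_)
  simp only [← sub_mul]
  exact abs_integral_cell_sub_quadInterp_mul_le hh hv h3 h4 hw hw_nonneg hk hk_var
    (Finset.mem_range.1 hm)

lemma quadrature_const_le {γ L : ℝ} (hγ0 : 0 ≤ γ) (hγ : γ < 1) (hh : 0 < h) (hL : h ≤ L)
    (hK₃ : 0 ≤ K₃) (hK₄ : 0 ≤ K₄) :
    3 * K₄ * (h / 2) ^ 4 * (2 / (1 - γ) * L ^ (1 - γ))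
        + K₃ * (h / 2) ^ 3 * ((2 / (1 - γ) + 2) * h ^ (1 - γ))
        + 2 * K₃ * (h / 2) ^ 4 * (2 / h ^ γ) ≤
      (K₃ + K₄ * L) / (1 - γ) * h ^ (4 - γ) := by
  have hL0 : 0 < L := hh.trans_le hL
  have hγ1 : 0 < 1 - γ := sub_pos.2 hγ
  have hpow_three : h ^ 3 * h ^ (1 - γ) = h ^ (4 - γ) := by
    rw [← Real.rpow_natCast, ← Real.rpow_add hh]
    norm_num
    ring_nf
  have hpow_four : h ^ 4 = h ^ (4 - γ) * h ^ γ := by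
    rw [← Real.rpow_add hh, sub_add_cancel]
    norm_cast
  have hpow_le : h ^ 4 * L ^ (1 - γ) ≤ h ^ (4 - γ) * L := by
    calc h ^ 4 * L ^ (1 - γ) ≤ h ^ (4 - γ) * L ^ γ * L ^ (1 - γ) := by
          rw [hpow_four]
          gcongr
      _ = h ^ (4 - γ) * L := by
          rw [mul_assoc, ← Real.rpow_add hL0, add_sub_cancel, Real.rpow_one]
  have hpow_div : h ^ 4 / h ^ γ = h ^ (4 - γ) := by
    rw [hpow_four, mul_div_cancel_right₀ _ (by positivity)]
  have hone : 1 ≤ (1 - γ)⁻¹ := (one_le_inv₀ hγ1).2 (by linarith)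
  calc _ = 3 / 8 * K₄ * (1 - γ)⁻¹ * (h ^ 4 * L ^ (1 - γ))
        + 1 / 4 * K₃ * ((1 - γ)⁻¹ + 1) * (h ^ 3 * h ^ (1 - γ)) + 1 / 4 * K₃ * (h ^ 4 / h ^ γ) := by
        ring
    _ ≤ 1 * K₄ * (1 - γ)⁻¹ * (h ^ (4 - γ) * L)
        + 1 / 4 * K₃ * ((1 - γ)⁻¹ + (1 - γ)⁻¹) * h ^ (4 - γ)
        + 1 / 4 * K₃ * ((1 - γ)⁻¹ * h ^ (4 - γ)) := by
        rw [hpow_three, hpow_div]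
        gcongr
        · norm_num
        · exact le_mul_of_one_le_left (by positivity) hone
    _ ≤ 1 * K₄ * (1 - γ)⁻¹ * (h ^ (4 - γ) * L) + K₃ * ((1 - γ)⁻¹ * h ^ (4 - γ)) := by
        have : 0 ≤ K₃ * ((1 - γ)⁻¹ * h ^ (4 - γ)) := by positivity
        linarith
    _ = _ := by ring

lemma abs_integral_sub_quadInterp_mul_kernel_le {γ : ℝ} (hγ0 : 0 ≤ γ) (hγ : γ < 1) (hh : 0 < h)
    (hM : 1 ≤ M) (hv : ContDiffOn ℝ 4 v (Icc a (mesh a h M)))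
    (h3 : ∀ x ∈ Icc a (mesh a h M), |iteratedDerivWithin 3 v (Icc a (mesh a h M)) x| ≤ K₃)
    (h4 : ∀ x ∈ Icc a (mesh a h M), |iteratedDerivWithin 4 v (Icc a (mesh a h M)) x| ≤ K₄)
    {x : ℝ} (hx : x ∈ Icc a (mesh a h M)) :
    |(∫ y in a..(mesh a h M), v y * kernel γ x y)
        - ∫ y in a..(mesh a h M), quadInterp a h M v y * kernel γ x y| ≤
      (K₃ + K₄ * (mesh a h M - a)) / (1 - γ) * h ^ (4 - γ) := by
  have hK₃ : 0 ≤ K₃ := (abs_nonneg _).trans (h3 x hx)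
  have hK₄ : 0 ≤ K₄ := (abs_nonneg _).trans (h4 x hx)
  have hstep_le : h ≤ mesh a h M - a := by
    have : (1 : ℝ) ≤ M := by exact_mod_cast hM
    unfold mesh
    nlinarith
  have hvar := eVariationOn_truncKernel_le hγ0 hh hx
  have hquad := abs_integral_sub_quadInterp_mul_le hh hv h3 h4
    (intervalIntegrable_kernel hγ x a _) (kernel_nonneg x)
    ((continuous_truncKernel (γ := γ) hh x).intervalIntegrable a _)
    (ne_top_of_le_ne_top ENNReal.ofReal_ne_top hvar)
  refine (hquad.trans ?_).trans (quadrature_const_le hγ0 hγ hh hstep_le hK₃ hK₄)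
  gcongr
  · exact integral_kernel_le hγ hx
  · exact integral_abs_kernel_sub_truncKernel_le hγ0 hγ hh (hx.1.trans hx.2) x
  · exact ENNReal.toReal_le_of_le_ofReal (by positivity) hvar

lemma integral_quadInterp_one_mul_kernel {γ : ℝ} (hγ0 : 0 ≤ γ) (hγ : γ < 1) (hh : 0 < h)
    (hM : 1 ≤ M) {x : ℝ} (hx : x ∈ Icc a (mesh a h M)) :
    ∫ y in a..(mesh a h M), quadInterp a h M (fun _ => 1) y * kernel γ x y =
      ∫ y in a..(mesh a h M), kernel γ x y := by
  have hquad := abs_integral_sub_quadInterp_mul_kernel_le (v := fun _ => 1) (K₃ := 0) (K₄ := 0)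
    hγ0 hγ hh hM contDiffOn_const (fun x _ => by simp [iteratedDerivWithin_const])
    (fun x _ => by simp [iteratedDerivWithin_const]) hx
  simp only [one_mul, zero_mul, add_zero, zero_div] at hquad
  exact (sub_eq_zero.1 (abs_nonpos_iff.1 hquad)).symm

end Quadrature

section Positivity

lemma integral_sub_mul_nonneg {c r : ℝ} (hr : 0 ≤ r) {φ : ℝ → ℝ}
    (hint : IntervalIntegrable (fun y => (y - c) * φ y) volume (c - r) (c + r))
    (hφ : ∀ s ∈ Icc 0 r, φ (c - s) ≤ φ (c + s)) :
    0 ≤ ∫ y in (c - r)..(c + r), (y - c) * φ y := by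
  set F : ℝ → ℝ := fun y => (y - c) * φ y with hF
  have hleft : 2 * c - (c - r) = c + r := by ring
  have hright : 2 * c - (c + r) = c - r := by ring
  have hint' : IntervalIntegrable (fun y => F (2 * c - y)) volume (c - r) (c + r) := by
    simpa only [hleft, hright] using (hint.comp_sub_left (2 * c)).symm
  have hreflect : ∫ y in (c - r)..(c + r), F (2 * c - y) = ∫ y in (c - r)..(c + r), F y := by
    rw [intervalIntegral.integral_comp_sub_left F, hleft, hright]
  have hpair : 0 ≤ ∫ y in (c - r)..(c + r), (F y + F (2 * c - y)) := by
    refine intervalIntegral.integral_nonneg (by linarith) fun y hy => ?_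
    have hsum : F y + F (2 * c - y) = (y - c) * (φ y - φ (2 * c - y)) := by
      simp only [hF]
      ring
    rw [hsum]
    rcases le_total c y with hcy | hyc
    · have hle := hφ (y - c) ⟨by linarith, by linarith [hy.2]⟩
      rw [show c - (y - c) = 2 * c - y by ring, add_sub_cancel] at hle
      exact mul_nonneg (sub_nonneg.2 hcy) (sub_nonneg.2 hle)
    · have hle := hφ (c - y) ⟨by linarith, by linarith [hy.1]⟩
      rw [show c + (c - y) = 2 * c - y by ring, sub_sub_cancel] at hle
      exact mul_nonneg_of_nonpos_of_nonpos (sub_nonpos.2 hyc) (sub_nonpos.2 hle)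
  rw [intervalIntegral.integral_add hint hint', hreflect] at hpair
  linarith

variable {γ : ℝ}

lemma mul_rpow_le_mul_rpow_of_mul_le_mul (hγ0 : 0 ≤ γ) (hγ : γ ≤ 1) {p q s t : ℝ} (hp : 0 ≤ p)
    (hpq : p ≤ q) (hs : 0 ≤ s) (ht : 0 ≤ t) (h : p * s ≤ q * t) : p * s ^ γ ≤ q * t ^ γ := by
  have hsplit : ∀ {p s : ℝ}, 0 ≤ p → 0 ≤ s → p * s ^ γ = p ^ (1 - γ) * (p * s) ^ γ := by
    intro p s hp hs
    rw [Real.mul_rpow hp hs, ← mul_assoc, ← Real.rpow_add_of_nonneg hp (sub_nonneg.2 hγ) hγ0,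
      sub_add_cancel, Real.rpow_one]
  rw [hsplit hp hs, hsplit (hp.trans hpq) ht]
  have hq : 0 ≤ q := hp.trans hpq
  have : 0 ≤ 1 - γ := sub_nonneg.2 hγ
  gcongr

variable {c r x : ℝ}

lemma sub_mul_kernel_le_add_mul_kernel (hγ0 : 0 ≤ γ) (hγ : γ ≤ 1) (hx : x = c ∨ r ≤ |x - c|)
    {s : ℝ} (hs : s ∈ Icc 0 r) :
    (r - s) * kernel γ x (c - s) ≤ (r + s) * kernel γ x (c + s) := by
  obtain ⟨hs0, hsr⟩ := hs
  rcases hsr.eq_or_lt with rfl | hsr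
  · rw [sub_self, zero_mul]
    exact mul_nonneg (by linarith) (kernel_nonneg _ _)
  have hdist : 0 < |x - (c - s)| → 0 < |x - (c + s)| →
      (r - s) * |x - (c + s)| ≤ (r + s) * |x - (c - s)| →
      (r - s) * kernel γ x (c - s) ≤ (r + s) * kernel γ x (c + s) := by
    intro hminus hplus hle
    rw [← div_abs_sub_rpow, ← div_abs_sub_rpow, div_le_div_iff₀ (by positivity) (by positivity)]
    exact mul_rpow_le_mul_rpow_of_mul_le_mul hγ0 hγ (by linarith) (by linarith) hplus.le hminus.le
      hle
  rcases hx with rfl | hx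
  · rw [← div_abs_sub_rpow, ← div_abs_sub_rpow, sub_sub_cancel, sub_add_cancel_left, abs_neg]
    gcongr
    linarith
  rcases le_abs'.1 hx with hx | hx
  · rw [abs_of_neg (by linarith), abs_of_neg (by linarith)] at hdist
    exact hdist (by linarith) (by linarith) (by nlinarith)
  · rw [abs_of_pos (by linarith), abs_of_pos (by linarith)] at hdist
    exact hdist (by linarith) (by linarith) (by nlinarith)

lemma integral_right_endpoint_mul_kernel_nonneg (hγ0 : 0 ≤ γ) (hγ : γ < 1) (hr : 0 ≤ r)
    (hx : x = c ∨ r ≤ |x - c|) :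
    0 ≤ ∫ y in (c - r)..(c + r), (y - c) * (y - c + r) * kernel γ x y := by
  have hnonneg := integral_sub_mul_nonneg (c := c) (φ := fun y => (y - c + r) * kernel γ x y) hr
    ?_ ?_
  · simpa only [mul_assoc] using hnonneg
  · simpa only [mul_assoc] using (intervalIntegrable_kernel hγ x (c - r) (c + r)).continuousOn_mul
      (g := fun y => (y - c) * (y - c + r)) (by fun_prop)
  · intro s hs
    convert sub_mul_kernel_le_add_mul_kernel hγ0 hγ.le hx hs using 2 <;> ring

lemma integral_left_endpoint_mul_kernel_nonneg (hγ0 : 0 ≤ γ) (hγ : γ < 1) (hr : 0 ≤ r)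
    (hx : x = c ∨ r ≤ |x - c|) :
    0 ≤ ∫ y in (c - r)..(c + r), (y - c) * (y - c - r) * kernel γ x y := by
  have hx' : 2 * c - x = c ∨ r ≤ |2 * c - x - c| := by
    refine hx.imp (fun hx => by linarith) fun hx => ?_
    rwa [show 2 * c - x - c = -(x - c) by ring, abs_neg]
  have hreflect := intervalIntegral.integral_comp_sub_left (a := c - r) (b := c + r)
    (fun y => (y - c) * (y - c - r) * kernel γ x y) (2 * c)
  rw [show 2 * c - (c - r) = c + r by ring, show 2 * c - (c + r) = c - r by ring] at hreflect
  rw [← hreflect]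
  refine (integral_right_endpoint_mul_kernel_nonneg hγ0 hγ hr hx').trans_eq
    (intervalIntegral.integral_congr fun y _ => ?_)
  simp only [kernel]
  rw [show x - (2 * c - y) = -(2 * c - x - y) by ring, abs_neg]
  ring

variable {a h : ℝ}

lemma integral_cell_quadBasis_mul_kernel_nonneg (hγ0 : 0 ≤ γ) (hγ : γ < 1) (hh : 0 < h) {m : ℕ}
    (hx : x = cellMid a h m ∨ h / 2 ≤ |x - cellMid a h m|) (l : ℕ) :
    0 ≤ ∫ y in (cellMid a h m - h / 2)..(cellMid a h m + h / 2),
      quadBasis a h l y * kernel γ x y := by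
  have hle : cellMid a h m - h / 2 ≤ cellMid a h m + h / 2 := by linarith
  have hlocal : ∀ {q : ℝ → ℝ}, (∀ y, |y - cellMid a h m| < h / 2 → quadBasis a h l y = q y) →
      ∫ y in (cellMid a h m - h / 2)..(cellMid a h m + h / 2), quadBasis a h l y * kernel γ x y =
        ∫ y in (cellMid a h m - h / 2)..(cellMid a h m + h / 2), q y * kernel γ x y := by
    intro q hq
    refine intervalIntegral.integral_congr_uIoo fun y hy => ?_
    rw [uIoo_of_le hle] at hy
    simp only [hq y (abs_lt.2 ⟨by linarith [hy.1], by linarith [hy.2]⟩)]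
  by_cases hl : l ∈ Finset.Icc (2 * m) (2 * m + 2)
  · rw [Finset.mem_Icc] at hl
    obtain rfl | rfl | rfl : l = 2 * m ∨ l = 2 * m + 1 ∨ l = 2 * m + 2 := by omega
    · rw [hlocal fun y => quadBasis_even]
      simp only [div_mul_eq_mul_div, intervalIntegral.integral_div]
      exact div_nonneg (integral_left_endpoint_mul_kernel_nonneg hγ0 hγ (by linarith) hx)
        (by positivity)
    · rw [hlocal fun y => quadBasis_odd]
      refine intervalIntegral.integral_nonneg hle fun y hy => ?_
      have hsq : (y - cellMid a h m) ^ 2 ≤ (h / 2) ^ 2 :=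
        sq_le_sq' (by linarith [hy.1]) (by linarith [hy.2])
      exact mul_nonneg (div_nonneg (sub_nonneg.2 hsq) (by positivity)) (kernel_nonneg _ _)
    · rw [hlocal fun y => quadBasis_even_succ]
      simp only [div_mul_eq_mul_div, intervalIntegral.integral_div]
      exact div_nonneg (integral_right_endpoint_mul_kernel_nonneg hγ0 hγ (by linarith) hx)
        (by positivity)
  · rw [hlocal (q := fun _ => 0) fun y hy => quadBasis_eq_zero hy hl]
    simp

lemma mesh_eq_cellMid_or_half_le_abs_sub (hh : 0 ≤ h) (n m : ℕ) :
    mesh a h (n / 2) = cellMid a h m ∨ h / 2 ≤ |mesh a h (n / 2) - cellMid a h m| := by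
  have hsub : mesh a h (n / 2) - cellMid a h m = ((n - (2 * m + 1) : ℤ) : ℝ) * (h / 2) := by
    unfold cellMid mesh
    push_cast
    ring
  rcases eq_or_ne (n - (2 * m + 1) : ℤ) 0 with hzero | hne
  · rw [hzero, Int.cast_zero, zero_mul, sub_eq_zero] at hsub
    exact Or.inl hsub
  · right
    rw [hsub, abs_mul, abs_of_nonneg (by linarith : 0 ≤ h / 2)]
    exact le_mul_of_one_le_left (by linarith) (by exact_mod_cast Int.one_le_abs hne)

lemma integral_quadBasis_mul_kernel_nonneg (hγ0 : 0 ≤ γ) (hγ : γ < 1) (hh : 0 < h) (M l n : ℕ) :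
    0 ≤ ∫ y in a..(mesh a h M), quadBasis a h l y * kernel γ (mesh a h (n / 2)) y := by
  rw [← sum_integral_cells hh
    (intervalIntegrable_quadBasis_mul hh l (intervalIntegrable_kernel hγ _ _ _))]
  exact Finset.sum_nonneg fun m _ => integral_cell_quadBasis_mul_kernel_nonneg hγ0 hγ hh
    (mesh_eq_cellMid_or_half_le_abs_sub hh.le n m) l

end Positivity

section Stability

variable {ι : Type*} [Fintype ι] {d : ι → ℝ} {G : Matrix ι ι ℝ}

lemma abs_mulVec_le_mul_norm (hG : ∀ i j, 0 ≤ G i j) (hd : ∀ i, ∑ j, G i j ≤ d i) (v : ι → ℝ)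
    (i : ι) : |(G.mulVec v) i| ≤ d i * ‖v‖ :=
  calc |∑ j, G i j * v j| ≤ ∑ j, |G i j * v j| := Finset.abs_sum_le_sum_abs _ _
    _ ≤ ∑ j, G i j * ‖v‖ := Finset.sum_le_sum fun j _ => by
        rw [abs_mul, abs_of_nonneg (hG i j)]
        exact mul_le_mul_of_nonneg_left (norm_le_pi_norm v j) (hG i j)
    _ ≤ d i * ‖v‖ := by
        rw [← Finset.sum_mul]
        exact mul_le_mul_of_nonneg_right (hd i) (norm_nonneg v)

variable [DecidableEq ι]

lemma diagonal_sub_mulVec_apply (v : ι → ℝ) (i : ι) :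
    (Matrix.diagonal d - G).mulVec v i = d i * v i - G.mulVec v i := by
  rw [Matrix.sub_mulVec, Pi.sub_apply, Matrix.mulVec_diagonal]

lemma norm_diagonal_sub_mulVec_le (hG : ∀ i j, 0 ≤ G i j) (hd : ∀ i, ∑ j, G i j ≤ d i) {D : ℝ}
    (hD0 : 0 ≤ D) (hD : ∀ i, d i ≤ D) (v : ι → ℝ) :
    ‖(Matrix.diagonal d - G).mulVec v‖ ≤ 2 * D * ‖v‖ := by
  refine (pi_norm_le_iff_of_nonneg (by positivity)).2 fun i => ?_
  have hdi : 0 ≤ d i := (Finset.sum_nonneg fun j _ => hG i j).trans (hd i)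
  rw [diagonal_sub_mulVec_apply, Real.norm_eq_abs]
  calc |d i * v i - G.mulVec v i| ≤ |d i * v i| + |G.mulVec v i| := abs_sub _ _
    _ ≤ d i * ‖v‖ + d i * ‖v‖ := by
        rw [abs_mul, abs_of_nonneg hdi]
        gcongr
        exacts [norm_le_pi_norm v i, abs_mulVec_le_mul_norm hG hd v i]
    _ ≤ 2 * D * ‖v‖ := by
        rw [← two_mul, ← mul_assoc]
        gcongr
        exact hD i

-- A discrete maximum principle: compare both sides at an index where `|v i|` is largest.
lemma norm_le_norm_add_smul_diagonal_sub_mulVec (hG : ∀ i j, 0 ≤ G i j)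
    (hd : ∀ i, ∑ j, G i j ≤ d i) {c : ℝ} (hc : 0 ≤ c) (v : ι → ℝ) :
    ‖v‖ ≤ ‖v + c • (Matrix.diagonal d - G).mulVec v‖ := by
  cases isEmpty_or_nonempty ι
  · simp [Subsingleton.elim v 0]
  obtain ⟨k, hk⟩ := Finite.exists_max fun i => |v i|
  have hnorm : ‖v‖ = |v k| :=
    le_antisymm ((pi_norm_le_iff_of_nonempty v).2 hk) (norm_le_pi_norm v k)
  have hdk : 0 ≤ d k := (Finset.sum_nonneg fun j _ => hG k j).trans (hd k)
  set w := v + c • (Matrix.diagonal d - G).mulVec v with hw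
  have hwk : (1 + c * d k) * v k = w k + c * G.mulVec v k := by
    rw [hw, Pi.add_apply, Pi.smul_apply, diagonal_sub_mulVec_apply, smul_eq_mul]
    ring
  have hle : (1 + c * d k) * ‖v‖ ≤ ‖w‖ + c * (d k * ‖v‖) :=
    calc (1 + c * d k) * ‖v‖ = |w k + c * G.mulVec v k| := by
          rw [← hwk, abs_mul, abs_of_nonneg (by positivity), hnorm]
      _ ≤ |w k| + |c * G.mulVec v k| := abs_add_le _ _
      _ ≤ ‖w‖ + c * (d k * ‖v‖) := by
          rw [abs_mul, abs_of_nonneg hc]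
          gcongr
          exacts [norm_le_pi_norm w k, abs_mulVec_le_mul_norm hG hd v k]
  linarith

lemma one_add_smul_mulVec (c : ℝ) (A : Matrix ι ι ℝ) (v : ι → ℝ) :
    (1 + c • A).mulVec v = v + c • A.mulVec v := by
  rw [Matrix.add_mulVec, Matrix.one_mulVec, Matrix.smul_mulVec]

lemma bijective_one_add_smul_diagonal_sub_mulVec (hG : ∀ i j, 0 ≤ G i j)
    (hd : ∀ i, ∑ j, G i j ≤ d i) {c : ℝ} (hc : 0 ≤ c) :
    Function.Bijective (1 + c • (Matrix.diagonal d - G)).mulVec := by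
  have hinj : Function.Injective (1 + c • (Matrix.diagonal d - G)).mulVec := by
    intro v w hvw
    have hnorm := norm_le_norm_add_smul_diagonal_sub_mulVec hG hd hc (v - w)
    rw [← one_add_smul_mulVec, Matrix.mulVec_sub, hvw, sub_self, norm_zero] at hnorm
    exact sub_eq_zero.1 (norm_le_zero_iff.1 hnorm)
  exact ⟨hinj, Matrix.mulVec_surjective_iff_isUnit.2 (Matrix.mulVec_injective_iff_isUnit.1 hinj)⟩

lemma existsUnique_implicit_recursion {V W : Type*} {N : ℕ} {B : V → W} (hB : Function.Bijective B)
    (v₀ : V) (R : Fin N → V → W) :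
    ∃! U : Fin (N + 1) → V, U 0 = v₀ ∧ ∀ k : Fin N, B (U k.succ) = R k (U k.castSucc) := by
  set E := Equiv.ofBijective B hB
  refine ⟨Fin.induction v₀ fun k v => E.symm (R k v), ⟨rfl, fun k => ?_⟩, ?_⟩
  · simp only [Fin.induction_succ]
    exact E.apply_symm_apply _
  · rintro U ⟨hzero, hsucc⟩
    funext k
    induction k using Fin.induction with
    | zero => exact hzero
    | succ k ih =>
      simp only [Fin.induction_succ, ← ih, ← hsucc k]
      exact (E.symm_apply_apply _).symm

lemma le_mul_exp_of_le_one_add_mul_add {N : ℕ} {ε : Fin (N + 1) → ℝ} {c r : ℝ} (hc : 0 ≤ c)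
    (hr : 0 ≤ r) (hzero : ε 0 ≤ 0) (hstep : ∀ k : Fin N, ε k.succ ≤ (1 + c) * ε k.castSucc + r)
    (k : Fin (N + 1)) : ε k ≤ k * r * Real.exp (k * c) := by
  induction k using Fin.induction with
  | zero => simpa using hzero
  | succ k ih =>
    rw [Fin.val_castSucc] at ih
    rw [Fin.val_succ]
    calc ε k.succ ≤ (1 + c) * ε k.castSucc + r := hstep k
      _ ≤ (1 + c) * (k * r * Real.exp (k * c)) + r := by gcongr
      _ ≤ Real.exp c * (k * r * Real.exp (k * c)) + r * Real.exp ((k + 1 : ℕ) * c) := by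
          gcongr
          · linarith [Real.add_one_le_exp c]
          · exact le_mul_of_one_le_right hr (Real.one_le_exp (by positivity))
      _ = (k + 1 : ℕ) * r * Real.exp ((k + 1 : ℕ) * c) := by
          push_cast
          rw [add_one_mul, Real.exp_add]
          ring

lemma norm_le_of_crankNicolson_recursion {E : Type*} [NormedAddCommGroup E] [NormedSpace ℝ E]
    {A : E → E} {D τ R : ℝ} (hD : 0 ≤ D) (hτ : 0 ≤ τ) (hR : 0 ≤ R)
    (hA : ∀ v, ‖A v‖ ≤ 2 * D * ‖v‖) (hstable : ∀ v, ‖v‖ ≤ ‖v + (τ / 2) • A v‖) {N : ℕ}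
    {e : Fin (N + 1) → E} {ρ : Fin N → E} (hzero : e 0 = 0) (hρ : ∀ k, ‖ρ k‖ ≤ R)
    (he : ∀ k : Fin N, e k.succ + (τ / 2) • A (e k.succ) =
      e k.castSucc - (τ / 2) • A (e k.castSucc) + τ • ρ k) (k : Fin (N + 1)) :
    ‖e k‖ ≤ k * τ * R * Real.exp (k * τ * D) := by
  have hstep : ∀ k : Fin N, ‖e k.succ‖ ≤ (1 + τ * D) * ‖e k.castSucc‖ + τ * R := fun k =>
    calc ‖e k.succ‖ ≤ ‖e k.castSucc - (τ / 2) • A (e k.castSucc) + τ • ρ k‖ := by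
          rw [← he k]
          exact hstable _
      _ ≤ ‖e k.castSucc‖ + τ / 2 * ‖A (e k.castSucc)‖ + τ * ‖ρ k‖ := by
          refine (norm_add_le _ _).trans (add_le_add ((norm_sub_le _ _).trans_eq ?_) (le_of_eq ?_))
          · rw [norm_smul, Real.norm_of_nonneg (by positivity)]
          · rw [norm_smul, Real.norm_of_nonneg hτ]
      _ ≤ ‖e k.castSucc‖ + τ / 2 * (2 * D * ‖e k.castSucc‖) + τ * R := by
          gcongr
          exacts [hA _, hρ k]
      _ = (1 + τ * D) * ‖e k.castSucc‖ + τ * R := by ring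
  refine (le_mul_exp_of_le_one_add_mul_add (ε := fun k => ‖e k‖) (by positivity) (by positivity)
    (by simp [hzero]) hstep k).trans_eq ?_
  simp only [mul_assoc]

end Stability

section Scheme

variable {a b γ τ T : ℝ} {M : ℕ}

lemma step_pos (hab : a < b) (hM : 1 ≤ M) : 0 < step a b M :=
  div_pos (sub_pos.2 hab) (by exact_mod_cast hM)

lemma mesh_step_last (a b : ℝ) (hM : 1 ≤ M) : mesh a (step a b M) M = b := by
  have hM0 : (M : ℝ) ≠ 0 := by exact_mod_cast Nat.one_le_iff_ne_zero.1 hM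
  rw [mesh, step, mul_div_cancel₀ _ hM0, add_sub_cancel]

lemma node_eq_mesh (a b : ℝ) (i : Fin (2 * M - 1)) :
    node a b M i = mesh a (step a b M) (((i + 1 : ℕ) : ℝ) / 2) := by
  rw [node, Nat.cast_add_one]

lemma node_mem_Ioo (hab : a < b) (hM : 1 ≤ M) (i : Fin (2 * M - 1)) : node a b M i ∈ Ioo a b := by
  have hmono := mesh_strictMono (a := a) (step_pos hab hM)
  have hi : ((i : ℕ) + 1 : ℝ) < 2 * M := by exact_mod_cast (by omega : (i : ℕ) + 1 < 2 * M)
  constructor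
  · simpa only [node, mesh_zero] using hmono (show (0 : ℝ) < ((i : ℕ) + 1 : ℝ) / 2 by positivity)
  · simpa only [node, mesh_step_last a b hM] using
      hmono (show ((i : ℕ) + 1 : ℝ) / 2 < (M : ℝ) by linarith)

lemma diagCoeff_eq_integral_kernel (i : Fin (2 * M - 1)) :
    diagCoeff a b γ M i = ∫ y in a..b, kernel γ (node a b M i) y :=
  rfl

lemma weight_eq_integral_mul_kernel (i : Fin (2 * M - 1)) (l : ℕ) :
    weight a b γ M i l = ∫ y in a..b, quadBasis a (step a b M) l y * kernel γ (node a b M i) y := by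
  simp only [weight, div_abs_sub_rpow]

lemma weight_nonneg (hab : a < b) (hγ0 : 0 ≤ γ) (hγ : γ < 1) (hM : 1 ≤ M) (i : Fin (2 * M - 1))
    (l : ℕ) : 0 ≤ weight a b γ M i l := by
  rw [weight_eq_integral_mul_kernel, node_eq_mesh]
  simpa only [mesh_step_last a b hM] using
    integral_quadBasis_mul_kernel_nonneg (a := a) hγ0 hγ (step_pos hab hM) M l (i + 1)

lemma integral_quadInterp_mul_kernel_node (hab : a < b) (hγ : γ < 1) (hM : 1 ≤ M) (v : ℝ → ℝ)
    (i : Fin (2 * M - 1)) :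
    ∫ y in a..b, quadInterp a (step a b M) M v y * kernel γ (node a b M i) y =
      ∑ l ∈ Finset.range (2 * M + 1), v (mesh a (step a b M) (l / 2)) * weight a b γ M i l := by
  simp only [integral_quadInterp_mul (step_pos hab hM) M v (intervalIntegrable_kernel hγ _ a b),
    weight_eq_integral_mul_kernel]

lemma sum_weight (hab : a < b) (hγ0 : 0 ≤ γ) (hγ : γ < 1) (hM : 1 ≤ M) (i : Fin (2 * M - 1)) :
    ∑ l ∈ Finset.range (2 * M + 1), weight a b γ M i l = diagCoeff a b γ M i := by
  have hone := integral_quadInterp_one_mul_kernel (a := a) (x := node a b M i) hγ0 hγ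
    (step_pos hab hM) hM
  rw [mesh_step_last a b hM] at hone
  simpa only [integral_quadInterp_mul_kernel_node hab hγ hM, one_mul,
    diagCoeff_eq_integral_kernel] using hone (Ioo_subset_Icc_self (node_mem_Ioo hab hM i))

lemma sum_range_eq_interior_add_boundary (hM : 1 ≤ M) (g : ℕ → ℝ) :
    ∑ l ∈ Finset.range (2 * M + 1), g l =
      (∑ j : Fin (2 * M - 1), g ((j : ℕ) + 1)) + (g 0 + g (2 * M)) := by
  obtain ⟨n, hn⟩ : ∃ n, 2 * M = n + 1 := ⟨2 * M - 1, by omega⟩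
  rw [hn, Finset.sum_range_succ, Finset.sum_range_succ',
    Fin.sum_univ_eq_sum_range (fun j => g (j + 1)), Nat.add_sub_cancel]
  ring

lemma sum_interior_weight_le (hab : a < b) (hγ0 : 0 ≤ γ) (hγ : γ < 1) (hM : 1 ≤ M)
    (i : Fin (2 * M - 1)) :
    ∑ j : Fin (2 * M - 1), weight a b γ M i ((j : ℕ) + 1) ≤ diagCoeff a b γ M i := by
  rw [← sum_weight hab hγ0 hγ hM i, sum_range_eq_interior_add_boundary hM]
  linarith [weight_nonneg hab hγ0 hγ hM i 0, weight_nonneg hab hγ0 hγ hM i (2 * M)]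

/-- A bound for the diagonal coefficients `d_{i/2}` that is uniform in the mesh: the integral of the
kernel over an interval of length `2 (b - a)` centred at the singularity. -/
noncomputable def diagBound (a b γ : ℝ) : ℝ := 2 / (1 - γ) * (b - a) ^ (1 - γ)

lemma diagBound_nonneg (hab : a ≤ b) (hγ : γ ≤ 1) : 0 ≤ diagBound a b γ :=
  mul_nonneg (div_nonneg zero_le_two (sub_nonneg.2 hγ)) (Real.rpow_nonneg (sub_nonneg.2 hab) _)

lemma diagCoeff_le_diagBound (hab : a < b) (hγ : γ < 1) (hM : 1 ≤ M) (i : Fin (2 * M - 1)) :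
    diagCoeff a b γ M i ≤ diagBound a b γ :=
  integral_kernel_le hγ (Ioo_subset_Icc_self (node_mem_Ioo hab hM i))

lemma norm_stiffness_mulVec_le (hab : a < b) (hγ0 : 0 ≤ γ) (hγ : γ < 1) (hM : 1 ≤ M)
    (v : Fin (2 * M - 1) → ℝ) : ‖(stiffness a b γ M).mulVec v‖ ≤ 2 * diagBound a b γ * ‖v‖ :=
  norm_diagonal_sub_mulVec_le (fun i _ => weight_nonneg hab hγ0 hγ hM i _)
    (sum_interior_weight_le hab hγ0 hγ hM) (diagBound_nonneg hab.le hγ.le)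
    (diagCoeff_le_diagBound hab hγ hM) v

lemma norm_le_norm_add_smul_stiffness_mulVec (hab : a < b) (hγ0 : 0 ≤ γ) (hγ : γ < 1)
    (hM : 1 ≤ M) {c : ℝ} (hc : 0 ≤ c) (v : Fin (2 * M - 1) → ℝ) :
    ‖v‖ ≤ ‖v + c • (stiffness a b γ M).mulVec v‖ :=
  norm_le_norm_add_smul_diagonal_sub_mulVec (fun i _ => weight_nonneg hab hγ0 hγ hM i _)
    (sum_interior_weight_le hab hγ0 hγ hM) hc v

lemma existsUnique_isSchemeSolution (hab : a < b) (hγ0 : 0 ≤ γ) (hγ : γ < 1) (hM : 1 ≤ M)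
    (hτ : 0 ≤ τ) (f : ℝ → ℝ → ℝ) (u₀ ga gb : ℝ → ℝ) (N : ℕ) :
    ∃! U, IsSchemeSolution a b γ f u₀ ga gb M N τ U := by
  have hbij : Function.Bijective (1 + (τ / 2) • stiffness a b γ M).mulVec :=
    bijective_one_add_smul_diagonal_sub_mulVec (fun i _ => weight_nonneg hab hγ0 hγ hM i _)
      (sum_interior_weight_le hab hγ0 hγ hM) (by positivity)
  simpa only [IsSchemeSolution, funext_iff] using
    existsUnique_implicit_recursion (N := N) hbij (fun i => u₀ (node a b M i)) fun k v =>
      (1 - (τ / 2) • stiffness a b γ M).mulVec v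
        + τ • (fun i => f (node a b M i) ((k + 1 / 2 : ℝ) * τ))
        + τ • boundaryVec a b γ M (ga ((k + 1 / 2 : ℝ) * τ)) (gb ((k + 1 / 2 : ℝ) * τ))

/-- The restriction of a function on `[a, b]` to the interior nodes. -/
noncomputable def nodeValues (a b : ℝ) (M : ℕ) (v : ℝ → ℝ) : Fin (2 * M - 1) → ℝ :=
  fun i => v (node a b M i)

lemma stiffness_mulVec_nodeValues_sub_boundaryVec (hab : a < b) (hγ : γ < 1) (hM : 1 ≤ M)
    (v : ℝ → ℝ) (i : Fin (2 * M - 1)) :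
    (stiffness a b γ M).mulVec (nodeValues a b M v) i - boundaryVec a b γ M (v a) (v b) i =
      v (node a b M i) * diagCoeff a b γ M i
        - ∫ y in a..b, quadInterp a (step a b M) M v y * kernel γ (node a b M i) y := by
  have hfirst : mesh a (step a b M) (((0 : ℕ) : ℝ) / 2) = a := by simp [mesh]
  have hlast : mesh a (step a b M) (((2 * M : ℕ) : ℝ) / 2) = b := by
    rw [Nat.cast_mul, Nat.cast_two, mul_div_cancel_left₀ _ two_ne_zero, mesh_step_last a b hM]
  rw [integral_quadInterp_mul_kernel_node hab hγ hM, sum_range_eq_interior_add_boundary hM, hfirst,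
    hlast, stiffness, diagonal_sub_mulVec_apply, boundaryVec]
  simp only [Matrix.mulVec, dotProduct, Matrix.of_apply, nodeValues, node_eq_mesh, mul_comm]
  ring

lemma integral_sub_div_abs_sub_rpow (hγ : γ < 1) {v : ℝ → ℝ} (hv : ContinuousOn v (uIcc a b))
    (c x : ℝ) :
    ∫ y in a..b, (c - v y) / |x - y| ^ γ =
      c * (∫ y in a..b, kernel γ x y) - ∫ y in a..b, v y * kernel γ x y := by
  have hkernel := intervalIntegrable_kernel hγ x a b
  simp only [div_abs_sub_rpow, sub_mul]
  rw [intervalIntegral.integral_sub (hkernel.const_mul c) (hkernel.continuousOn_mul hv),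
    intervalIntegral.integral_const_mul]

lemma abs_stiffness_mulVec_sub_boundaryVec_sub_le {K₃ K₄ : ℝ} (hab : a < b) (hγ0 : 0 ≤ γ)
    (hγ : γ < 1) (hM : 1 ≤ M) {v : ℝ → ℝ} (hv : ContDiffOn ℝ 4 v (Icc a b))
    (h3 : ∀ x ∈ Icc a b, |iteratedDerivWithin 3 v (Icc a b) x| ≤ K₃)
    (h4 : ∀ x ∈ Icc a b, |iteratedDerivWithin 4 v (Icc a b) x| ≤ K₄) (i : Fin (2 * M - 1)) :
    |(stiffness a b γ M).mulVec (nodeValues a b M v) i - boundaryVec a b γ M (v a) (v b) i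
        - ∫ y in a..b, (v (node a b M i) - v y) / |node a b M i - y| ^ γ| ≤
      (K₃ + K₄ * (b - a)) / (1 - γ) * step a b M ^ (4 - γ) := by
  have hquad := abs_integral_sub_quadInterp_mul_kernel_le (a := a) (v := v) (K₃ := K₃) (K₄ := K₄)
    (x := node a b M i) hγ0 hγ (step_pos hab hM) hM
  rw [mesh_step_last a b hM] at hquad
  refine (congrArg abs ?_).trans_le (hquad hv h3 h4 (Ioo_subset_Icc_self (node_mem_Ioo hab hM i)))
  rw [stiffness_mulVec_nodeValues_sub_boundaryVec hab hγ hM,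
    integral_sub_div_abs_sub_rpow hγ (by rw [uIcc_of_le hab.le]; exact hv.continuousOn)]
  rw [diagCoeff_eq_integral_kernel]
  ring

/-- The residual of the function `u` in the scheme, divided by the time step, for the step from
`t - τ / 2` to `t + τ / 2`. -/
noncomputable def truncationError (a b γ : ℝ) (f : ℝ → ℝ → ℝ) (ga gb : ℝ → ℝ) (u : ℝ → ℝ → ℝ)
    (M : ℕ) (τ t : ℝ) : Fin (2 * M - 1) → ℝ :=
  τ⁻¹ • (nodeValues a b M (u · (t + τ / 2)) - nodeValues a b M (u · (t - τ / 2)))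
    + (stiffness a b γ M).mulVec
      ((1 / 2 : ℝ) • (nodeValues a b M (u · (t + τ / 2)) + nodeValues a b M (u · (t - τ / 2))))
    - nodeValues a b M (f · t) - boundaryVec a b γ M (ga t) (gb t)

variable {f u : ℝ → ℝ → ℝ} {u₀ ga gb : ℝ → ℝ}

lemma truncationError_eq (hab : a < b) (hM : 1 ≤ M) (hτ : τ ≠ 0)
    (hu : IsExactSolution a b T γ f u₀ ga gb u) {t : ℝ} (ht : t ∈ Ioc 0 T) (i : Fin (2 * M - 1)) :
    truncationError a b γ f ga gb u M τ t i =
      (u (node a b M i) (t + τ / 2) - u (node a b M i) (t - τ / 2)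
          - τ * derivWithin (u (node a b M i)) (Icc 0 T) t) / τ
        + (stiffness a b γ M).mulVec ((1 / 2 : ℝ) • (nodeValues a b M (u · (t + τ / 2))
          + nodeValues a b M (u · (t - τ / 2))) - nodeValues a b M (u · t)) i
        + ((stiffness a b γ M).mulVec (nodeValues a b M (u · t)) i
          - boundaryVec a b γ M (u a t) (u b t) i
          - ∫ y in a..b, (u (node a b M i) t - u y t) / |node a b M i - y| ^ γ) := by
  rw [Matrix.mulVec_sub, hu.left t ht, hu.right t ht]
  simp only [truncationError, nodeValues, Pi.sub_apply, Pi.add_apply, Pi.smul_apply, smul_eq_mul,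
    ← hu.eqn _ (node_mem_Ioo hab hM i) t ht]
  field_simp
  ring

lemma norm_average_sub_nodeValues_le {K₂ t : ℝ} (hab : a < b) (hM : 1 ≤ M)
    (hs : IsSmooth a b T u)
    (hK₂ : ∀ x ∈ Icc a b, ∀ t ∈ Icc 0 T, |iteratedDerivWithin 2 (u x) (Icc 0 T) t| ≤ K₂)
    (hτ : 0 < τ) (ht : 0 ≤ t - τ / 2) (ht' : t + τ / 2 ≤ T) :
    ‖(1 / 2 : ℝ) • (nodeValues a b M (u · (t + τ / 2)) + nodeValues a b M (u · (t - τ / 2)))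
        - nodeValues a b M (u · t)‖ ≤ K₂ * (τ / 2) ^ 2 := by
  have hK₂0 : 0 ≤ K₂ :=
    (abs_nonneg _).trans (hK₂ a (left_mem_Icc.2 hab.le) t ⟨by linarith, by linarith⟩)
  refine (pi_norm_le_iff_of_nonneg (by positivity)).2 fun i => ?_
  have hx : node a b M i ∈ Icc a b := Ioo_subset_Icc_self (node_mem_Ioo hab hM i)
  rw [Real.norm_eq_abs]
  convert abs_average_sub_le (half_pos hτ) ht ht' ((hs.time _ hx).of_le (by norm_num)) (hK₂ _ hx)
    using 2
  simp only [nodeValues, Pi.sub_apply, Pi.add_apply, Pi.smul_apply, smul_eq_mul]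
  ring

lemma norm_truncationError_le {K₂ K₃ J₃ J₄ t : ℝ} (hab : a < b) (hγ0 : 0 ≤ γ) (hγ : γ < 1)
    (hM : 1 ≤ M) (hs : IsSmooth a b T u) (hu : IsExactSolution a b T γ f u₀ ga gb u)
    (hK₂ : ∀ x ∈ Icc a b, ∀ t ∈ Icc 0 T, |iteratedDerivWithin 2 (u x) (Icc 0 T) t| ≤ K₂)
    (hK₃ : ∀ x ∈ Icc a b, ∀ t ∈ Icc 0 T, |iteratedDerivWithin 3 (u x) (Icc 0 T) t| ≤ K₃)
    (hJ₃ : ∀ x ∈ Icc a b, ∀ t ∈ Icc 0 T, |iteratedDerivWithin 3 (u · t) (Icc a b) x| ≤ J₃)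
    (hJ₄ : ∀ x ∈ Icc a b, ∀ t ∈ Icc 0 T, |iteratedDerivWithin 4 (u · t) (Icc a b) x| ≤ J₄)
    (hτ : 0 < τ) (ht : 0 ≤ t - τ / 2) (ht' : t + τ / 2 ≤ T) :
    ‖truncationError a b γ f ga gb u M τ t‖ ≤ (K₃ / 4 + diagBound a b γ * K₂ / 2) * τ ^ 2
      + (J₃ + J₄ * (b - a)) / (1 - γ) * step a b M ^ (4 - γ) := by
  have : 0 < 1 - γ := sub_pos.2 hγ
  have : 0 < b - a := sub_pos.2 hab
  have hD := diagBound_nonneg hab.le hγ.le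
  have hh := step_pos hab hM
  have htI : t ∈ Ioc 0 T := ⟨by linarith, by linarith⟩
  have htI' := Ioc_subset_Icc_self htI
  have ha := left_mem_Icc.2 hab.le
  have hK₂0 : 0 ≤ K₂ := (abs_nonneg _).trans (hK₂ a ha t htI')
  have hK₃0 : 0 ≤ K₃ := (abs_nonneg _).trans (hK₃ a ha t htI')
  have hJ₃0 : 0 ≤ J₃ := (abs_nonneg _).trans (hJ₃ a ha t htI')
  have hJ₄0 : 0 ≤ J₄ := (abs_nonneg _).trans (hJ₄ a ha t htI')
  refine (pi_norm_le_iff_of_nonneg (by positivity)).2 fun i => ?_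
  have hx : node a b M i ∈ Icc a b := Ioo_subset_Icc_self (node_mem_Ioo hab hM i)
  have htime : |(u (node a b M i) (t + τ / 2) - u (node a b M i) (t - τ / 2)
      - τ * derivWithin (u (node a b M i)) (Icc 0 T) t) / τ| ≤ K₃ * τ ^ 2 / 4 := by
    have hcentral := abs_central_difference_sub_le (half_pos hτ) ht ht' (hs.time _ hx) (hK₃ _ hx)
    rw [mul_div_cancel₀ τ two_ne_zero] at hcentral
    rw [abs_div, abs_of_pos hτ, div_le_iff₀ hτ]
    exact hcentral.trans_eq (by ring)
  have haverage := (norm_le_pi_norm _ i).trans <|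
    (norm_stiffness_mulVec_le hab hγ0 hγ hM _).trans <| mul_le_mul_of_nonneg_left
      (norm_average_sub_nodeValues_le hab hM hs hK₂ hτ ht ht') (by positivity)
  have hspace := abs_stiffness_mulVec_sub_boundaryVec_sub_le hab hγ0 hγ hM (hs.space t htI')
    (fun x hx => hJ₃ x hx t htI') (fun x hx => hJ₄ x hx t htI') i
  rw [truncationError_eq hab hM hτ.ne' hu htI i]
  refine (abs_add_three _ _ _).trans ((add_le_add_three htime haverage hspace).trans_eq ?_)
  ring

lemma exists_bound_of_continuousOn_prod {F : ℝ × ℝ → ℝ}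
    (hF : ContinuousOn F (Icc a b ×ˢ Icc 0 T)) :
    ∃ K, 0 ≤ K ∧ ∀ x ∈ Icc a b, ∀ t ∈ Icc 0 T, |F (x, t)| ≤ K := by
  obtain ⟨K, hK⟩ := (isCompact_Icc.prod isCompact_Icc).exists_bound_of_continuousOn hF
  exact ⟨max K 0, le_max_right _ _, fun x hx t ht => (hK (x, t) ⟨hx, ht⟩).trans (le_max_left _ _)⟩

lemma exists_norm_truncationError_le (hab : a < b) (hγ0 : 0 ≤ γ) (hγ : γ < 1)
    (hs : IsSmooth a b T u) (hu : IsExactSolution a b T γ f u₀ ga gb u) :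
    ∃ C, 0 ≤ C ∧ ∀ (M : ℕ) (τ t : ℝ), 1 ≤ M → 0 < τ → 0 ≤ t - τ / 2 → t + τ / 2 ≤ T →
      ‖truncationError a b γ f ga gb u M τ t‖ ≤ C * (τ ^ 2 + step a b M ^ (4 - γ)) := by
  obtain ⟨K₂, hK₂0, hK₂⟩ := exists_bound_of_continuousOn_prod (hs.time_cont 2 (by norm_num))
  obtain ⟨K₃, hK₃0, hK₃⟩ := exists_bound_of_continuousOn_prod (hs.time_cont 3 le_rfl)
  obtain ⟨J₃, hJ₃0, hJ₃⟩ := exists_bound_of_continuousOn_prod (hs.space_cont 3 (by norm_num))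
  obtain ⟨J₄, hJ₄0, hJ₄⟩ := exists_bound_of_continuousOn_prod (hs.space_cont 4 le_rfl)
  have hD := diagBound_nonneg hab.le hγ.le
  have hCτ : 0 ≤ K₃ / 4 + diagBound a b γ * K₂ / 2 := by positivity
  have hCh : 0 ≤ (J₃ + J₄ * (b - a)) / (1 - γ) :=
    div_nonneg (add_nonneg hJ₃0 (mul_nonneg hJ₄0 (sub_pos.2 hab).le)) (sub_pos.2 hγ).le
  refine ⟨_, add_nonneg hCτ hCh, fun M τ t hM hτ ht ht' => ?_⟩
  have hstep := (step_pos hab hM).le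
  refine (norm_truncationError_le hab hγ0 hγ hM hs hu hK₂ hK₃ hJ₃ hJ₄ hτ ht ht').trans ?_
  rw [mul_add]
  exact add_le_add (mul_le_mul_of_nonneg_right (le_add_of_nonneg_right hCh) (by positivity))
    (mul_le_mul_of_nonneg_right (le_add_of_nonneg_left hCτ) (by positivity))

lemma error_recursion (hτ : τ ≠ 0) {N : ℕ} {U : Fin (N + 1) → Fin (2 * M - 1) → ℝ}
    (hU : IsSchemeSolution a b γ f u₀ ga gb M N τ U) {e : Fin (N + 1) → Fin (2 * M - 1) → ℝ}
    (he : ∀ k, e k = nodeValues a b M (u · (k * τ)) - U k) (k : Fin N) :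
    e k.succ + (τ / 2) • (stiffness a b γ M).mulVec (e k.succ) =
      e k.castSucc - (τ / 2) • (stiffness a b γ M).mulVec (e k.castSucc)
        + τ • truncationError a b γ f ga gb u M τ ((k + 1 / 2) * τ) := by
  have hscheme := hU.2 k
  rw [Matrix.add_mulVec, Matrix.sub_mulVec, Matrix.one_mulVec, Matrix.one_mulVec,
    Matrix.smul_mulVec, Matrix.smul_mulVec] at hscheme
  have hplus : ((k : ℝ) + 1 / 2) * τ + τ / 2 = (k + 1 : ℕ) * τ := by push_cast; ring
  have hminus : ((k : ℝ) + 1 / 2) * τ - τ / 2 = k * τ := by ring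
  rw [truncationError, hplus, hminus, he, he, Fin.val_succ, Fin.val_castSucc]
  simp only [Matrix.mulVec_sub, Matrix.mulVec_smul, Matrix.mulVec_add]
  funext i
  have hscheme_i := congrFun hscheme i
  simp only [nodeValues, Pi.add_apply, Pi.sub_apply, Pi.smul_apply, smul_eq_mul] at hscheme_i ⊢
  generalize ((k : ℝ) + 1 / 2) * τ = t at hscheme_i ⊢
  field_simp
  linear_combination (-2) * hscheme_i

lemma norm_nodeValues_sub_le {R : ℝ} {N : ℕ} {U : Fin (N + 1) → Fin (2 * M - 1) → ℝ} (hab : a < b)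
    (hγ0 : 0 ≤ γ) (hγ : γ < 1) (hM : 1 ≤ M) (hτ : 0 < τ) (hR : 0 ≤ R)
    (hinitial : ∀ x ∈ Ioo a b, u x 0 = u₀ x) (hU : IsSchemeSolution a b γ f u₀ ga gb M N τ U)
    (htrunc : ∀ k : Fin N, ‖truncationError a b γ f ga gb u M τ ((k + 1 / 2) * τ)‖ ≤ R)
    (k : Fin (N + 1)) :
    ‖nodeValues a b M (u · (k * τ)) - U k‖ ≤
      k * τ * R * Real.exp (k * τ * diagBound a b γ) := by
  refine norm_le_of_crankNicolson_recursion (diagBound_nonneg hab.le hγ.le) hτ.le hR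
    (norm_stiffness_mulVec_le hab hγ0 hγ hM)
    (norm_le_norm_add_smul_stiffness_mulVec hab hγ0 hγ hM (half_pos hτ).le)
    (e := fun k => nodeValues a b M (u · (k * τ)) - U k) ?_ htrunc
    (error_recursion hτ.ne' hU fun _ => rfl) k
  funext i
  simp [nodeValues, hU.1 i, hinitial _ (node_mem_Ioo hab hM i)]

end Scheme

end NonlocalCN

open NonlocalCN in
theorem theorem3p7 (a b T γ : ℝ) (hab : a < b) (hT : 0 < T) (hγ0 : 0 < γ) (hγ1 : γ < 1)
    (f : ℝ → ℝ → ℝ) (u₀ ga gb : ℝ → ℝ) (u : ℝ → ℝ → ℝ)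
    (hsmooth : NonlocalCN.IsSmooth a b T u) (hu : NonlocalCN.IsExactSolution a b T γ f u₀ ga gb u) :
    ∃ C : ℝ, 0 < C ∧ ∀ (M N : ℕ) (τ : ℝ), 1 ≤ M → 0 < τ → (N : ℝ) * τ ≤ T →
      (∃! U, NonlocalCN.IsSchemeSolution a b γ f u₀ ga gb M N τ U) ∧
      ∀ U, NonlocalCN.IsSchemeSolution a b γ f u₀ ga gb M N τ U →
        ∀ (k : Fin (N + 1)) (i : Fin (2 * M - 1)),
          |u (NonlocalCN.node a b M i) ((k : ℕ) * τ) - U k i|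
            ≤ C * (τ ^ 2 + NonlocalCN.step a b M ^ (4 - γ)) := by
  obtain ⟨C, hC, htrunc⟩ := exists_norm_truncationError_le hab hγ0.le hγ1 hsmooth hu
  have hD := diagBound_nonneg hab.le hγ1.le
  refine ⟨T * C * Real.exp (T * diagBound a b γ) + 1, by positivity, fun M N τ hM hτ hN =>
    ⟨existsUnique_isSchemeSolution hab hγ0.le hγ1 hM hτ.le f u₀ ga gb N, fun U hU k i => ?_⟩⟩
  have hk : (k : ℝ) * τ ≤ T := hN.trans' (by gcongr; exact k.is_le)
  set ε := τ ^ 2 + step a b M ^ (4 - γ)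
  have hε : 0 ≤ ε := add_nonneg (sq_nonneg τ) (Real.rpow_nonneg (step_pos hab hM).le _)
  have htrunc_step : ∀ m : Fin N,
      ‖truncationError a b γ f ga gb u M τ ((m + 1 / 2) * τ)‖ ≤ C * ε := fun m => by
    have hm : ((m : ℝ) + 1) * τ ≤ T := hN.trans' (by gcongr; exact_mod_cast m.2)
    have hm0 : 0 ≤ (m : ℝ) * τ := by positivity
    exact htrunc M τ _ hM hτ (by linarith) (by linarith)
  calc |u (node a b M i) (k * τ) - U k i| ≤ ‖nodeValues a b M (u · (k * τ)) - U k‖ :=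
        norm_le_pi_norm (nodeValues a b M (u · (k * τ)) - U k) i
    _ ≤ k * τ * (C * ε) * Real.exp (k * τ * diagBound a b γ) :=
        norm_nodeValues_sub_le hab hγ0.le hγ1 hM hτ (by positivity) hu.initial hU htrunc_step k
    _ ≤ T * (C * ε) * Real.exp (T * diagBound a b γ) := by gcongr
    _ ≤ (T * C * Real.exp (T * diagBound a b γ) + 1) * ε := by linarith
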